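/- **Model.** At most $n$ processes, prone to crashes, run asynchronously and communicate by atomic reads and writes of shared registers, all initially $\mathtt{null}$. The processes have distinct original names in $[N]=\{1,\dots,N\}$. The code of a process may depend on $n$, $N$ and its own original name, but not on the number $k\le n$ of contending processes. Each read or write is one local step. An algorithm is (wait-free, one-time) *$N$-renaming for unknown $k$ with new names of magnitude at most $M(k)$, operating in $T(k)$ local steps*, if in every execution with any set of $k\le n$ contending processes no two of them acquire the same new name, every acquired name is in $\{1,\dots,\lfloor M(k)\rfloor\}$, and each process that is scheduled at least $T(k)$ times acquires a new name, whatever the other processes do (including crashing). **Graphs.** Write $\lg$ for the logarithm to base $2$. A bipartite graph with inputs $[V]$ and outputs $[W]$, in which each input has exactly $\Delta$ neighbours, is an $(L,\Delta,\varepsilon)$-lossless-expander if each nonempty $X\subseteq[V]$ with $|X|\le L$ has more than $(1-\varepsilon)|X|\Delta$ neighbours. For integers $1\le L\le V/(200e^4)$ let $W(L,V)=\lceil 12e^4L\lg(V/L)\rceil$ and $\Delta(L,V)=\lceil 4\lg(V/L)\rceil$, and let $G_{L,V}$ be an $(L,\Delta(L,V),\frac14)$-lossless-expander with inputs $[V]$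 and outputs $[W(L,V)]$, with ordered adjacency lists. **Algorithm.** * *Compete-For-Register*$(R)$, for a process with current name $p$, uses a second register $H_R$: read $H_R$, and exit if it is not $\mathtt{null}$; write $p$ to $H_R$; read $R$, and exit if it is not $\mathtt{null}$; write $p$ to $R$; read $H_R$, and win if its value is $p$, otherwise exit. * *Majority*$(L,V)$: a process with current name $p\in[V]$ competes, one by one, for the registers of the neighbours of $p$ in $G_{L,V}$ until it wins one, whose number it adopts; if it wins none, it fails. * *Basic-Rename*$(2^i,V)$: a process runs Majority$(2^{i-s},V)$ in stages $s=0,1,\dots,i$ until it gets a name. The stages use disjoint consecutive sets of names, of total size $\sum_{s=0}^{i}W(2^{i-s},V)$. * *PolyLog-Rename*$(2^i,N)$: let $N_1=N$ and let $N_{j+1}$ be the size of the range of names of Basic-Rename$(2^i,N_j)$. In epochs $j=1,2,\dots$, as long as $N_j>768e^4\,2^i$, a process runs Basic-Rename$(2^i,N_j)$, starting from the name obtained in the preceding epoch (the original name if $j=1$). It fails if an epoch gives it no name. Its name after the last epoch is its name from PolyLog-Rename. * *Almost-Adaptive*$(N)$: a process, always starting from its original name, runs PolyLog-Rename$(2^i,N)$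 for $i=0,1,\dots,\lceil\lg n\rceil$ until it obtains a new name. The phases $i$ use disjoint consecutive intervals of names. All stages, epochs and phases use disjoint sets of registers. **Claim.** Put $\log x=\max\{1,\lg x\}$ in the bounds below. Graphs $G_{L,V}$ as above exist for all $1\le L\le V/(200e^4)$. There is an absolute constant $A$ such that, for all $n\ge1$ and all choices of the graphs $G_{L,V}$: 1. If $N\le c\,n$, then Almost-Adaptive$(N)$ is $N$-renaming for unknown $k$ with new names of magnitude at most $Ak$. It operates in at most $B\log^2k\,(\log n+\log k\,\log\log n)$ local steps and uses at most $Bn$ registers, where $B$ depends only on $c$. 2. If $N\le c\,n^d$, then Almost-Adaptive$(N)$ is $N$-renaming for unknown $k$ with new names of magnitude at most $Ak$. It operates in at most $B\log^2k\,(\log n+\log k\,\log\log n)$ local steps and uses at most $B\,n\log n$ registers, where $B$ depends only on $c$ and $d$. -/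

import Mathlib

namespace Renaming

/-! ### Asynchronous read-write shared memory -/

/-- Deterministic code of one process: it halts with an output, or reads a register and continues
according to the value seen (`none` is the initial value `null`), or writes a value to a register.
Each read and each write is one local step; local computation is free. -/
inductive Code (ρ α : Type) : Type
  | halt : α → Code ρ α
  | read : ρ → (Option ℕ → Code ρ α) → Code ρ α
  | write : ρ → ℕ → Code ρ α → Code ρ α

namespace Code

/-- Sequential composition. -/
def bind {ρ α β : Type} : Code ρ α → (α → Code ρ β) → Code ρ β
  | halt a, f => f a
  | read r g, f => read r (fun c => (g c).bind f)
  | write r v P, f => write r v (P.bind f)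

/-- All registers that occur in the code. -/
def registers {ρ α : Type} : Code ρ α → Set ρ
  | halt _ => ∅
  | read r g => {r} ∪ ⋃ c, (g c).registers
  | write r _ P => {r} ∪ P.registers

end Code

/-- The contents of the shared registers and the remaining code of every process; a process is
identified by its original name. -/
structure Config (ρ α : Type) where
  mem : ρ → Option ℕ
  code : ℕ → Code ρ α

/-- One step of process `p` (nothing happens if `p` has halted). -/
def Config.step {ρ α : Type} [DecidableEq ρ] (c : Config ρ α) (p : ℕ) : Config ρ α :=
  match c.code p with
  | .halt _ => c
  | .read r g => { c with code := Function.update c.code p (g (c.mem r)) }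
  | .write r v P =>
      { mem := Function.update c.mem r (some v), code := Function.update c.code p P }

/-- The configuration reached from the initial one (all registers `null`) under the schedule `σ`,
the sequence of the processes that take the successive steps. A process crashes by not being
scheduled any more. -/
def run {ρ α : Type} [DecidableEq ρ] (alg : ℕ → Code ρ α) (σ : List ℕ) : Config ρ α :=
  σ.foldl Config.step { mem := fun _ => none, code := alg }

/-- Under the schedule `σ`, process `p` has acquired the new name `x`. An output `none` means that
a process has stopped without a name. -/
def Acquired {ρ : Type} [DecidableEq ρ] (alg : ℕ → Code ρ (Option ℕ)) (σ : List ℕ) (p x : ℕ) :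
    Prop :=
  (run alg σ).code p = Code.halt (some x)

/-- `alg` is a wait-free one-time `N`-renaming algorithm for any contention `k ≤ n`, where `k` is
not known to the code: in every execution with set `K` of contending processes, `k = |K|`, with
original names in `[N]`, the new names are exclusive and in `{1, …, M k}`, and each process that
has been scheduled at least `T k` times, however the others are scheduled, has a new name. -/
structure IsRenaming {ρ : Type} [DecidableEq ρ] (n N : ℕ) (alg : ℕ → Code ρ (Option ℕ))
    (M T : ℕ → ℝ) : Prop where
  exclusive : ∀ K : Finset ℕ, K ⊆ Finset.Icc 1 N → K.card ≤ n →
    ∀ σ : List ℕ, (∀ p ∈ σ, p ∈ K) →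
      ∀ p ∈ K, ∀ q ∈ K, p ≠ q → ∀ x y : ℕ, Acquired alg σ p x → Acquired alg σ q y → x ≠ y
  bounded : ∀ K : Finset ℕ, K ⊆ Finset.Icc 1 N → K.card ≤ n →
    ∀ σ : List ℕ, (∀ p ∈ σ, p ∈ K) →
      ∀ p ∈ K, ∀ x : ℕ, Acquired alg σ p x → 1 ≤ x ∧ (x : ℝ) ≤ M K.card
  waitFree : ∀ K : Finset ℕ, K ⊆ Finset.Icc 1 N → K.card ≤ n →
    ∀ σ : List ℕ, (∀ p ∈ σ, p ∈ K) →
      ∀ p ∈ K, T K.card ≤ (σ.count p : ℝ) → ∃ x : ℕ, Acquired alg σ p x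

/-- The registers that the algorithm uses on original names in `[N]`. -/
def usedRegisters {ρ α : Type} (N : ℕ) (alg : ℕ → Code ρ α) : Set ρ :=
  ⋃ p ∈ Finset.Icc 1 N, (alg p).registers

/-- The algorithm uses at most `b` shared registers. -/
def UsesAtMost {ρ α : Type} (N : ℕ) (alg : ℕ → Code ρ α) (b : ℝ) : Prop :=
  (usedRegisters N alg).Finite ∧ ((usedRegisters N alg).ncard : ℝ) ≤ b

/-! ### Lossless expanders -/

/-- The simple bipartite graph with inputs `[V]`, outputs `[W]` and adjacency lists `Γ v` is an
`(L, Δ, ε)`-lossless-expander. -/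
structure IsLosslessExpander (V W L Δ : ℕ) (ε : ℝ) (Γ : ℕ → List ℕ) : Prop where
  nodup : ∀ v ∈ Finset.Icc 1 V, (Γ v).Nodup
  outputs : ∀ v ∈ Finset.Icc 1 V, ∀ w ∈ Γ v, w ∈ Finset.Icc 1 W
  degree : ∀ v ∈ Finset.Icc 1 V, (Γ v).length = Δ
  expands : ∀ X : Finset ℕ, X ⊆ Finset.Icc 1 V → X.Nonempty → X.card ≤ L →
    (1 - ε) * X.card * Δ < ((X.biUnion fun v => (Γ v).toFinset).card : ℝ)

/-- The number of outputs `⌈12 e⁴ L lg (V / L)⌉`. -/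
noncomputable def outSize (L V : ℕ) : ℕ :=
  ⌈12 * Real.exp 4 * L * Real.logb 2 ((V : ℝ) / L)⌉₊

/-- The input-degree `⌈4 lg (V / L)⌉`. -/
noncomputable def inDegree (L V : ℕ) : ℕ :=
  ⌈4 * Real.logb 2 ((V : ℝ) / L)⌉₊

/-- A choice, for all `1 ≤ L ≤ V / (200 e⁴)`, of an `(L, Δ, 1/4)`-lossless-expander with `V`
inputs; these graphs are a part of the code. -/
structure ExpanderFamily where
  nbr : ℕ → ℕ → ℕ → List ℕ
  isExpander : ∀ L V : ℕ, 1 ≤ L → (L : ℝ) ≤ V / (200 * Real.exp 4) →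
    IsLosslessExpander V (outSize L V) L (inDegree L V) (1 / 4) (nbr L V)

/-! ### The algorithm -/

/-- The shared registers: the pair `R` (`reserve = false`), `H_R` (`reserve = true`) that belongs
to a node (output) of the graph used in a given stage of a given epoch of a given phase. -/
structure Register where
  phase : ℕ
  epoch : ℕ
  stage : ℕ
  node : ℕ
  reserve : Bool
  deriving DecidableEq

/-- Procedure Compete-For-Register, executed by a process with current name `p`; the output says
whether `p` wins. -/
def compete {ρ : Type} (R H : ρ) (p : ℕ) : Code ρ Bool :=
  .read H fun c => if c = none then
    .write H p <| .read R fun c => if c = none then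
      .write R p <| .read H fun c => .halt (decide (c = some p))
    else .halt false
  else .halt false

/-- Compete for the nodes of the list one by one until the first win. -/
def competeAlong {ρ : Type} (R H : ℕ → ρ) (p : ℕ) : List ℕ → Code ρ (Option ℕ)
  | [] => .halt none
  | w :: ws => (compete (R w) (H w) p).bind fun won =>
      if won then .halt (some w) else competeAlong R H p ws

/-- Algorithm Majority`(L, N)`. -/
def majority (G : ExpanderFamily) (phase epoch stage L N p : ℕ) : Code Register (Option ℕ) :=
  competeAlong (fun w => ⟨phase, epoch, stage, w, false⟩) (fun w => ⟨phase, epoch, stage, w, true⟩)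
    p (G.nbr L N p)

/-- The total size of the sets of names of the stages `0, …, s - 1` of Basic-Rename`(2 ^ i, N)`. -/
noncomputable def stageOffset (i N s : ℕ) : ℕ :=
  ∑ t ∈ Finset.range s, outSize (2 ^ i / 2 ^ t) N

/-- The size of the range of new names of Basic-Rename`(2 ^ i, N)`. -/
noncomputable def basicRange (i N : ℕ) : ℕ := stageOffset i N (i + 1)

/-- Run Majority`(2 ^ i / 2 ^ s, N)` for the stages `s` of the list until a name is won; the sets
of names of different stages are disjoint. -/
noncomputable def basicStages (G : ExpanderFamily) (i epoch N p : ℕ) :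
    List ℕ → Code Register (Option ℕ)
  | [] => .halt none
  | s :: ss => (majority G i epoch s (2 ^ i / 2 ^ s) N p).bind fun
      | some w => .halt (some (stageOffset i N s + w))
      | none => basicStages G i epoch N p ss

/-- Algorithm Basic-Rename`(2 ^ i, N)`: the stages `0, …, i`. -/
noncomputable def basicRename (G : ExpanderFamily) (i epoch N p : ℕ) :
    Code Register (Option ℕ) :=
  basicStages G i epoch N p (List.range (i + 1))

/-- The size of the range of names after `t` epochs of PolyLog-Rename`(2 ^ i, N)`. -/
noncomputable def rangeAfter (i N : ℕ) : ℕ → ℕ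
  | 0 => N
  | t + 1 => basicRange i (rangeAfter i N t)

/-- The number of epochs of PolyLog-Rename`(2 ^ i, N)`: epochs are executed as long as the range
of names exceeds `768 e⁴ 2 ^ i`. -/
noncomputable def numEpochs (i N : ℕ) : ℕ :=
  sInf {t : ℕ | (rangeAfter i N t : ℝ) ≤ 768 * Real.exp 4 * 2 ^ i}

/-- The first `t` epochs of PolyLog-Rename`(2 ^ i, N)`, each one starting from the names obtained
in the preceding one. -/
noncomputable def polyLogEpochs (G : ExpanderFamily) (i N p : ℕ) : ℕ → Code Register (Option ℕ)
  | 0 => .halt (some p)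
  | t + 1 => (polyLogEpochs G i N p t).bind fun
      | some q => basicRename G i t (rangeAfter i N t) q
      | none => .halt none

/-- Algorithm PolyLog-Rename`(2 ^ i, N)`. -/
noncomputable def polyLogRename (G : ExpanderFamily) (i N p : ℕ) : Code Register (Option ℕ) :=
  polyLogEpochs G i N p (numEpochs i N)

/-- The total size of the intervals of names of PolyLog-Rename`(2 ^ l, N)` for `l < i`. -/
noncomputable def phaseOffset (N i : ℕ) : ℕ :=
  ∑ l ∈ Finset.range i, rangeAfter l N (numEpochs l N)

/-- Run PolyLog-Rename`(2 ^ i, N)` for the phases `i` of the list until a name is obtained; each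
phase has its own interval of names. -/
noncomputable def phases (G : ExpanderFamily) (N p : ℕ) : List ℕ → Code Register (Option ℕ)
  | [] => .halt none
  | i :: is => (polyLogRename G i N p).bind fun
      | some q => .halt (some (phaseOffset N i + q))
      | none => phases G N p is

/-- Algorithm Almost-Adaptive`(N)` in a system with `n` processes: the phases
`0, …, ⌈lg n⌉`, executed by the process with original name `p`. -/
noncomputable def almostAdaptive (G : ExpanderFamily) (n N : ℕ) (p : ℕ) :
    Code Register (Option ℕ) :=
  phases G N p (List.range (Nat.clog 2 n + 1))

/-! ### The bound on local steps -/

/-- The logarithm to base 2 in bounds, at least `1`. -/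
noncomputable def lg (x : ℝ) : ℝ := max 1 (Real.logb 2 x)

/-- `log² k (log n + log k log log n)`. -/
noncomputable def stepBound (n k : ℕ) : ℝ :=
  lg k ^ 2 * (lg n + lg k * lg (lg n))

end Renaming

/-! An execution is recorded as a global trace of reads and writes (`exists_trace`). Phases, epochs,
stages and nodes own disjoint registers, so restricting the trace to the registers of one procedure
yields an execution of that procedure alone, and composite code splits accordingly (`Exec.bind`,
`Exec.orElse`). Each procedure can thus be analysed in isolation, whatever the interleaving.

At a node, a winner finds its own name in `H_R` at the end, so nobody wrote `H_R` since its own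
write; this leaves room for one winner only (`compete_exclusive`), while a lone contender cannot
lose (`compete_alone`). By expansion with ε = 1/4, counting edges shows that more than half of at
most `L` contenders have a neighbour shared with no other contender, so fewer than half can fail
(`two_mul_card_lt_of_expands`, `competeAlong_majority`). Since `L` halves from stage to stage,
Basic-Rename serves any 2^i contenders (`basicStages_exec`), and no process needs a phase beyond ⌈lg
k⌉ (`phases_exec`).

With x = N_j / 2^i, an epoch replaces x by at most 24e⁴(lg x + 2), which is at most 3x/4 while
epochs go on (`basicRange_le`, `contraction`). The first epoch reduces x to the order of its
logarithm and the later ones shrink it geometrically. Hence there are O(log log n) epochs, yet the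
names handed out, and the logarithms of the ranges, add up over all epochs of a phase to multiples
of the initial logarithm. Summation over the phases gives the bounds on names, steps and registers.

The expanders exist by a union bound over all pairs of a small input set and a too small output set
containing its neighbours (`exists_expanding_of_sum_lt`, `expander_term_le`). -/

namespace Renaming

open Set

/-! ### Traces of executions -/

/-- An executed read or write, with the value read or written. -/
inductive Event (ρ : Type) : Type
  | rd : ρ → Option ℕ → Event ρ
  | wr : ρ → ℕ → Event ρ

/-- The register accessed. -/
def Event.reg {ρ : Type} : Event ρ → ρ
  | rd r _ => r
  | wr r _ => r

/-- `Path P es Q`: the code `P` can execute the events `es` and become the code `Q`. -/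
inductive Path {ρ α : Type} : Code ρ α → List (Event ρ) → Code ρ α → Prop
  | nil (P : Code ρ α) : Path P [] P
  | read {r : ρ} {g : Option ℕ → Code ρ α} (v : Option ℕ) {es : List (Event ρ)} {Q : Code ρ α} :
      Path (g v) es Q → Path (.read r g) (.rd r v :: es) Q
  | write {r : ρ} {v : ℕ} {P : Code ρ α} {es : List (Event ρ)} {Q : Code ρ α} :
      Path P es Q → Path (.write r v P) (.wr r v :: es) Q

/-- The outputs that occur in the code. -/
def Code.results {ρ α : Type} : Code ρ α → Set α
  | .halt a => {a}
  | .read _ g => ⋃ c, (g c).results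
  | .write _ _ P => P.results

/-! ### Paths under sequential composition. -/

section Paths

variable {ρ α β : Type}

theorem Path.append {P Q R : Code ρ α} {es fs : List (Event ρ)} (h : Path P es Q)
    (h' : Path Q fs R) : Path P (es ++ fs) R := by
  induction h with
  | nil => exact h'
  | read v _ ih => exact .read v (ih h')
  | write _ ih => exact .write (ih h')

theorem Path.of_halt {a : α} {es : List (Event ρ)} {Q : Code ρ α} (h : Path (.halt a) es Q) :
    es = [] ∧ Q = .halt a := by
  cases h
  exact ⟨rfl, rfl⟩

theorem Path.reg_mem {P Q : Code ρ α} {es : List (Event ρ)} (h : Path P es Q) :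
    ∀ e ∈ es, e.reg ∈ P.registers := by
  induction h with
  | nil => simp
  | read v _ ih =>
    intro e he
    rcases List.mem_cons.1 he with rfl | he
    · exact Or.inl rfl
    · exact Or.inr (mem_iUnion.2 ⟨v, ih e he⟩)
  | write _ ih =>
    intro e he
    rcases List.mem_cons.1 he with rfl | he
    · exact Or.inl rfl
    · exact Or.inr (ih e he)

theorem Path.result_mem {P Q : Code ρ α} {es : List (Event ρ)} (h : Path P es Q) {a : α}
    (hQ : Q = .halt a) : a ∈ P.results := by
  induction h with
  | nil => subst hQ; rfl
  | read v _ ih => exact mem_iUnion.2 ⟨v, ih hQ⟩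
  | write _ ih => exact ih hQ

/-- A composite halts only inside its second part. So a path that has not left `P` ends in code that
is not halted, which later excludes outputs of processes that never reach the second part. -/
theorem Path.bind_cases {P : Code ρ α} {f : α → Code ρ β} {es : List (Event ρ)} {Q : Code ρ β}
    (h : Path (P.bind f) es Q) :
    (∃ P', Path P es P' ∧ ∀ b, Q ≠ .halt b) ∨
      ∃ a es₁ es₂, es = es₁ ++ es₂ ∧ Path P es₁ (.halt a) ∧ Path (f a) es₂ Q := by
  induction P generalizing es with
  | halt a => exact .inr ⟨a, [], es, rfl, .nil _, h⟩
  | read r g ih =>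
    rw [Code.bind] at h
    cases h with
    | nil => exact .inl ⟨_, .nil _, by simp⟩
    | read v h =>
      rcases ih v h with ⟨P', h1, h2⟩ | ⟨a, e1, e2, rfl, h1, h2⟩
      · exact .inl ⟨P', .read v h1, h2⟩
      · exact .inr ⟨a, _, e2, rfl, .read v h1, h2⟩
  | write r v P ih =>
    rw [Code.bind] at h
    cases h with
    | nil => exact .inl ⟨_, .nil _, by simp⟩
    | write h =>
      rcases ih h with ⟨P', h1, h2⟩ | ⟨a, e1, e2, rfl, h1, h2⟩
      · exact .inl ⟨P', .write h1, h2⟩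
      · exact .inr ⟨a, _, e2, rfl, .write h1, h2⟩

/-- Only possible outputs of `P` enter the union: the registers of the continuation are under
control only for names in the proper range. -/
theorem Code.registers_bind (P : Code ρ α) (f : α → Code ρ β) :
    (P.bind f).registers ⊆ P.registers ∪ ⋃ a ∈ P.results, (f a).registers := by
  induction P with
  | halt a => simp [Code.bind, Code.registers, Code.results]
  | read r g ih =>
    intro x hx
    rcases hx with hx | hx
    · exact .inl (.inl hx)
    · obtain ⟨c, hc⟩ := mem_iUnion.1 hx
      rcases ih c hc with h | h
      · exact .inl (.inr (mem_iUnion.2 ⟨c, h⟩))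
      · obtain ⟨a, ha, hxa⟩ := mem_iUnion₂.1 h
        exact .inr (mem_iUnion₂.2 ⟨a, mem_iUnion.2 ⟨c, ha⟩, hxa⟩)
  | write r v P ih =>
    intro x hx
    rcases hx with hx | hx
    · exact .inl (.inl hx)
    · rcases ih hx with h | h
      · exact .inl (.inr h)
      · exact .inr h

theorem Code.results_bind (P : Code ρ α) (f : α → Code ρ β) :
    (P.bind f).results ⊆ ⋃ a ∈ P.results, (f a).results := by
  induction P with
  | halt a => simp [Code.bind, Code.results]
  | read r g ih =>
    intro x hx
    obtain ⟨c, hc⟩ := mem_iUnion.1 hx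
    obtain ⟨a, ha, hxa⟩ := mem_iUnion₂.1 (ih c hc)
    exact mem_iUnion₂.2 ⟨a, mem_iUnion.2 ⟨c, ha⟩, hxa⟩
  | write r v P ih => exact ih

end Paths

/-! ### Global traces, memory contents and their restriction to register sets. -/

section Traces

variable {ρ α β : Type}

/-- The memory after a global sequence of events, each one tagged with its process. -/
def memOf [DecidableEq ρ] (tr : List (ℕ × Event ρ)) : ρ → Option ℕ :=
  tr.foldl (fun m e => match e.2 with
    | .rd _ _ => m
    | .wr r v => Function.update m r (some v)) fun _ => none

/-- Every read returns the current contents of the register. -/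
def Valid [DecidableEq ρ] (tr : List (ℕ × Event ρ)) : Prop :=
  ∀ i p r v, tr[i]? = some (p, Event.rd r v) → memOf (tr.take i) r = v

open Classical in
/-- The events of the process `p` on the registers in `S`. -/
noncomputable def eventsOn (S : Set ρ) (p : ℕ) (tr : List (ℕ × Event ρ)) : List (Event ρ) :=
  (tr.filter fun e => e.1 = p ∧ e.2.reg ∈ S).map Prod.snd

theorem eventsOn_append (S : Set ρ) (p : ℕ) (tr tr' : List (ℕ × Event ρ)) :
    eventsOn S p (tr ++ tr') = eventsOn S p tr ++ eventsOn S p tr' := by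
  simp [eventsOn]

theorem eventsOn_filter {S S' : Set ρ} [DecidablePred fun e : Event ρ => e.reg ∈ S'] (h : S' ⊆ S)
    (p : ℕ) (tr : List (ℕ × Event ρ)) :
    (eventsOn S p tr).filter (fun e => e.reg ∈ S') = eventsOn S' p tr := by
  rw [eventsOn, eventsOn, List.filter_map, List.filter_filter]
  congr 1
  apply List.filter_congr
  intro e _
  simp only [Function.comp, Bool.decide_and]
  by_cases h1 : e.2.reg ∈ S'
  · simp [h1, h h1]
  · simp [h1]

theorem memOf_concat_rd [DecidableEq ρ] (tr : List (ℕ × Event ρ)) (p : ℕ) (r : ρ) (v : Option ℕ) :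
    memOf (tr ++ [(p, .rd r v)]) = memOf tr := by
  simp [memOf]

theorem memOf_concat_wr [DecidableEq ρ] (tr : List (ℕ × Event ρ)) (p : ℕ) (r : ρ) (v : ℕ) :
    memOf (tr ++ [(p, .wr r v)]) = Function.update (memOf tr) r (some v) := by
  simp [memOf]

theorem Valid.concat [DecidableEq ρ] {tr : List (ℕ × Event ρ)} (h : Valid tr) (e : ℕ × Event ρ)
    (he : ∀ r v, e.2 = .rd r v → memOf tr r = v) : Valid (tr ++ [e]) := by
  intro i p r v hi
  rcases lt_trichotomy i tr.length with hlt | rfl | hgt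
  · rw [List.getElem?_append_left hlt] at hi
    rw [List.take_append_of_le_length hlt.le]
    exact h i p r v hi
  · simp at hi
    simp
    exact he r v (by rw [hi])
  · rw [List.getElem?_eq_none (by simp; omega)] at hi
    cases hi

/-- Every execution has a valid trace. -/
theorem exists_trace [DecidableEq ρ] (alg : ℕ → Code ρ α) (σ : List ℕ) :
    ∃ tr : List (ℕ × Event ρ), Valid tr ∧ (run alg σ).mem = memOf tr ∧
      (∀ p, Path (alg p) (eventsOn univ p tr) ((run alg σ).code p)) ∧
      (∀ e ∈ tr, e.1 ∈ σ) ∧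
      ∀ p, (∃ a, (run alg σ).code p = .halt a) ∨ (eventsOn univ p tr).length = σ.count p := by
  induction σ using List.reverseRecOn with
  | nil =>
    refine ⟨[], ?_, rfl, fun p => .nil _, by simp, fun p => .inr rfl⟩
    intro i p r v h
    simp at h
  | append_singleton σ q ih =>
    obtain ⟨tr, hv, hm, hp, ht, hc⟩ := ih
    have hrun : run alg (σ ++ [q]) = (run alg σ).step q := by simp [run]
    rw [hrun]
    have one : ∀ (e : Event ρ) p, eventsOn univ p [(q, e)] = if p = q then [e] else [] := by
      intro e p
      by_cases h : p = q
      · subst h; simp [eventsOn]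
      · simp [eventsOn, h, Ne.symm h]
    have cnt : ∀ p, (σ ++ [q]).count p = σ.count p + if p = q then 1 else 0 := by
      intro p
      rw [List.count_append, List.count_singleton]
      by_cases h : p = q
      · simp [h]
      · simp [h, Ne.symm h]
    rcases hcode : (run alg σ).code q with a | ⟨r, g⟩ | ⟨r, v, P⟩
    -- A scheduled process that has halted produces no event, so the number of events equals the
    -- number of turns only for processes still running.
    · have hs : (run alg σ).step q = run alg σ := by simp [Config.step, hcode]
      rw [hs]
      refine ⟨tr, hv, hm, hp, fun e he => List.mem_append_left _ (ht e he), fun p => ?_⟩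
      by_cases h : p = q
      · exact .inl ⟨a, h ▸ hcode⟩
      · simpa [cnt, h] using hc p
    · have hs : (run alg σ).step q = { (run alg σ) with
          code := Function.update (run alg σ).code q (g ((run alg σ).mem r)) } := by
        simp [Config.step, hcode]
      rw [hs]
      refine ⟨tr ++ [(q, .rd r (memOf tr r))], hv.concat _ ?_, ?_, fun p => ?_, ?_, fun p => ?_⟩
      · rintro r' v h
        cases h
        rfl
      · rw [memOf_concat_rd]
        exact hm
      · rw [eventsOn_append, one]
        by_cases h : p = q
        · subst h
          have := hp p
          rw [hcode] at this
          simp only [if_true, Function.update_self, hm]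
          exact this.append (.read _ (.nil _))
        · simpa [h] using hp p
      · intro e he
        rcases List.mem_append.1 he with he | he
        · exact List.mem_append_left _ (ht e he)
        · simp at he
          simp [he]
      · rw [eventsOn_append, one, cnt]
        by_cases h : p = q
        · subst h
          rcases hc p with ⟨a, ha⟩ | hl
          · rw [hcode] at ha; cases ha
          · exact .inr (by simp [hl])
        · simpa [h] using hc p
    · have hs : (run alg σ).step q = { 
          mem := Function.update (run alg σ).mem r (some v)
          code := Function.update (run alg σ).code q P } := by
        simp [Config.step, hcode]
      rw [hs]
      refine ⟨tr ++ [(q, .wr r v)], hv.concat _ ?_, ?_, fun p => ?_, ?_, fun p => ?_⟩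
      · rintro r' v h
        cases h
      · rw [memOf_concat_wr, hm]
      · rw [eventsOn_append, one]
        by_cases h : p = q
        · subst h
          have := hp p
          rw [hcode] at this
          simp only [if_true, Function.update_self]
          exact this.append (.write (.nil _))
        · simpa [h] using hp p
      · intro e he
        rcases List.mem_append.1 he with he | he
        · exact List.mem_append_left _ (ht e he)
        · simp at he
          simp [he]
      · rw [eventsOn_append, one, cnt]
        by_cases h : p = q
        · subst h
          rcases hc p with ⟨a, ha⟩ | hl
          · rw [hcode] at ha; cases ha
          · exact .inr (by simp [hl])
        · simpa [h] using hc p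

theorem memOf_cases [DecidableEq ρ] (tr : List (ℕ × Event ρ)) (r : ρ) :
    (memOf tr r = none ∧ ∀ (j p v : ℕ), tr[j]? ≠ some (p, Event.wr r v)) ∨
      ∃ j p v : ℕ, tr[j]? = some (p, Event.wr r v) ∧ memOf tr r = some v ∧
        ∀ l, j < l → ∀ q w : ℕ, tr[l]? ≠ some (q, Event.wr r w) := by
  induction tr using List.reverseRecOn with
  | nil => simp [memOf]
  | append_singleton tr e ih =>
    by_cases he : ∃ p v, e = (p, .wr r v)
    · obtain ⟨p, v, rfl⟩ := he
      refine .inr ⟨tr.length, p, v, by simp, by simp [memOf_concat_wr], fun l hl q w h => ?_⟩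
      rw [List.getElem?_eq_none (by simp; omega)] at h
      cases h
    · have hm : memOf (tr ++ [e]) r = memOf tr r := by
        obtain ⟨p, r' | ⟨r', v⟩⟩ := e
        · rw [memOf_concat_rd]
        · rw [memOf_concat_wr, Function.update_of_ne]
          rintro rfl
          exact he ⟨_, _, rfl⟩
      have key : ∀ l q w : ℕ, (tr ++ [e])[l]? = some (q, Event.wr r w) →
          tr[l]? = some (q, Event.wr r w) := by
        intro l q w h
        rcases lt_trichotomy l tr.length with hlt | rfl | hgt
        · rwa [List.getElem?_append_left hlt] at h
        · simp at h
          exact absurd ⟨_, _, h⟩ he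
        · rw [List.getElem?_eq_none (by simp; omega)] at h
          cases h
      rw [hm]
      rcases ih with ⟨h1, h2⟩ | ⟨j, p, v, h1, h2, h3⟩
      · exact .inl ⟨h1, fun j p v h => h2 j p v (key _ _ _ h)⟩
      · refine .inr ⟨j, p, v, ?_, h2, fun l hl q w h => h3 l hl q w (key _ _ _ h)⟩
        rw [List.getElem?_append_left (List.getElem?_eq_some_iff.1 h1).1]
        exact h1

/-- Writes never restore `null`, so reading `null` certifies that the register is untouched so far.
-/
theorem Valid.not_written [DecidableEq ρ] {tr : List (ℕ × Event ρ)} (h : Valid tr) {i p : ℕ}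
    {r : ρ} (hi : tr[i]? = some (p, Event.rd r none)) {j : ℕ} (hj : j < i) (q w : ℕ) :
    tr[j]? ≠ some (q, Event.wr r w) := by
  have hm := h i p r none hi
  rcases memOf_cases (tr.take i) r with ⟨_, h2⟩ | ⟨_, _, v, _, h2, _⟩
  · have := h2 j q w
    rwa [List.getElem?_take_of_lt hj] at this
  · rw [hm] at h2
    cases h2

theorem Valid.last_write [DecidableEq ρ] {tr : List (ℕ × Event ρ)} (h : Valid tr) {i p : ℕ}
    {r : ρ} {v : ℕ} (hi : tr[i]? = some (p, Event.rd r (some v))) :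
    ∃ j q, j < i ∧ tr[j]? = some (q, Event.wr r v) ∧
      ∀ l, j < l → l < i → ∀ q w : ℕ, tr[l]? ≠ some (q, Event.wr r w) := by
  have hm := h i p r _ hi
  rcases memOf_cases (tr.take i) r with ⟨h2, _⟩ | ⟨j, q, v', h1, h2, h3⟩
  · rw [hm] at h2
    cases h2
  · rw [hm] at h2
    cases h2
    have hj : j < i := by
      by_contra hj
      rw [List.getElem?_eq_none (by simp; omega)] at h1
      cases h1
    refine ⟨j, q, hj, ?_, fun l hl hli q w hh => h3 l hl q w ?_⟩
    · rwa [List.getElem?_take_of_lt hj] at h1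
    · rwa [List.getElem?_take_of_lt hli]

theorem mem_eventsOn {S : Set ρ} {p : ℕ} {tr : List (ℕ × Event ρ)} {e : Event ρ} :
    e ∈ eventsOn S p tr ↔ (p, e) ∈ tr ∧ e.reg ∈ S := by
  simp [eventsOn, and_comm]

/-- Turns the program order of one process into an order of positions in the global trace. -/
theorem eventsOn_embedding (S : Set ρ) (p : ℕ) (tr : List (ℕ × Event ρ)) :
    ∃ f : ℕ ↪o ℕ, ∀ k e, (eventsOn S p tr)[k]? = some e → tr[f k]? = some (p, e) := by
  classical
  obtain ⟨f, hf⟩ := List.sublist_iff_exists_orderEmbedding_getElem?_eq.1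
    (List.filter_sublist (l := tr) (p := fun e => decide (e.1 = p ∧ e.2.reg ∈ S)))
  refine ⟨f, fun k e hk => ?_⟩
  rw [← hf]
  rw [eventsOn, List.getElem?_map, Option.map_eq_some_iff] at hk
  obtain ⟨⟨q, e'⟩, h1, rfl⟩ := hk
  have := List.mem_of_getElem? h1
  simp only [List.mem_filter, decide_eq_true_eq] at this
  rw [h1, this.2.1]

theorem index_unique {S : Set ρ} {p : ℕ} {tr : List (ℕ × Event ρ)} {e : Event ρ}
    (hS : e.reg ∈ S) (hn : (eventsOn S p tr).Nodup) {i j : ℕ} (hi : tr[i]? = some (p, e))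
    (hj : tr[j]? = some (p, e)) : i = j := by
  classical
  by_contra hij
  wlog hlt : i < j generalizing i j
  · exact this hj hi (Ne.symm hij) (by omega)
  have h1 : [(p, e), (p, e)].Sublist tr := by
    rw [← List.duplicate_iff_sublist, List.duplicate_iff_exists_distinct_get]
    obtain ⟨a, ha⟩ := List.getElem?_eq_some_iff.1 hi
    obtain ⟨b, hb⟩ := List.getElem?_eq_some_iff.1 hj
    exact ⟨⟨i, a⟩, ⟨j, b⟩, hlt, ha.symm, hb.symm⟩
  have h2 := (h1.filter fun e => decide (e.1 = p ∧ e.2.reg ∈ S)).map Prod.snd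
  rw [List.filter_cons_of_pos (by simp [hS]), List.filter_cons_of_pos (by simp [hS])] at h2
  exact List.nodup_iff_sublist.1 hn _ h2

/-! ### Concurrent executions of a procedure -/

/-- In the trace `tr`, on the registers of `S`, each process `p ∈ E` executes `P p`, which has
become `Q p`, and no other process takes a step. -/
structure Exec (tr : List (ℕ × Event ρ)) (S : Set ρ) (E : Finset ℕ) (P Q : ℕ → Code ρ α) :
    Prop where
  path : ∀ p ∈ E, Path (P p) (eventsOn S p tr) (Q p)
  idle : ∀ p ∉ E, eventsOn S p tr = []

theorem filter_eq_self_of_registers {P Q : Code ρ α} {es : List (Event ρ)} (h : Path P es Q)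
    {S : Set ρ} (hS : P.registers ⊆ S) [DecidablePred fun e : Event ρ => e.reg ∈ S] :
    es.filter (fun e => e.reg ∈ S) = es := by
  rw [List.filter_eq_self]
  intro e he
  simpa using hS (h.reg_mem e he)

theorem filter_eq_nil_of_registers {P Q : Code ρ α} {es : List (Event ρ)} (h : Path P es Q)
    {S : Set ρ} (hS : Disjoint P.registers S) [DecidablePred fun e : Event ρ => e.reg ∈ S] :
    es.filter (fun e => e.reg ∈ S) = [] := by
  rw [List.filter_eq_nil_iff]
  intro e he
  simpa using disjoint_left.1 hS (h.reg_mem e he)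

/-- Each local history is a part on `S₁` followed by a part on `S₂`, and disjointness lets
restriction recover both, although different processes pass from one to the other at different
times. `E₂` consists of the processes that have finished `P`, with outputs `A`. -/
theorem Exec.bind [Inhabited α] {tr : List (ℕ × Event ρ)} {S S₁ S₂ : Set ρ} {E : Finset ℕ}
    {P : ℕ → Code ρ α} {f : ℕ → α → Code ρ β} {Q : ℕ → Code ρ β}
    (h : Exec tr S E (fun p => (P p).bind (f p)) Q) (h₁ : S₁ ⊆ S) (h₂ : S₂ ⊆ S)
    (hd : Disjoint S₁ S₂) (hP : ∀ p ∈ E, (P p).registers ⊆ S₁)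
    (hf : ∀ p ∈ E, ∀ a ∈ (P p).results, (f p a).registers ⊆ S₂) :
    ∃ (Q₁ : ℕ → Code ρ α) (E₂ : Finset ℕ) (A : ℕ → α), E₂ ⊆ E ∧ Exec tr S₁ E P Q₁ ∧
      (∀ p ∈ E₂, Q₁ p = .halt (A p)) ∧ Exec tr S₂ E₂ (fun p => f p (A p)) Q ∧
      (∀ p ∈ E, p ∉ E₂ → ∀ b, Q p ≠ .halt b) ∧
      ∀ p ∈ E, eventsOn S p tr = eventsOn S₁ p tr ++ eventsOn S₂ p tr := by
  classical
  -- The flag `b` records whether `p` has finished its first part; `a` is a dummy value otherwise.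
  have key : ∀ p, ∃ (q : Code ρ α) (b : Bool) (a : α), p ∈ E →
      Path (P p) (eventsOn S₁ p tr) q ∧
      eventsOn S p tr = eventsOn S₁ p tr ++ eventsOn S₂ p tr ∧
      (b = true → q = .halt a ∧ Path (f p a) (eventsOn S₂ p tr) (Q p)) ∧
      (b = false → eventsOn S₂ p tr = [] ∧ ∀ c, Q p ≠ .halt c) := by
    intro p
    by_cases hp : p ∈ E
    swap
    · exact ⟨.halt default, true, default, fun h => absurd h hp⟩
    rcases (h.path p hp).bind_cases with ⟨P', h1, h2⟩ | ⟨a, e1, e2, he, h1, h2⟩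
    · have e1' : eventsOn S₁ p tr = eventsOn S p tr := by
        rw [← eventsOn_filter h₁, filter_eq_self_of_registers h1 (hP p hp)]
      have e2' : eventsOn S₂ p tr = [] := by
        rw [← eventsOn_filter h₂]
        exact filter_eq_nil_of_registers h1 (hd.mono_left (hP p hp))
      exact ⟨P', false, default, fun _ => ⟨e1' ▸ h1, by rw [e1', e2', List.append_nil], by simp,
        fun _ => ⟨e2', h2⟩⟩⟩
    · have hfa := hf p hp a (h1.result_mem rfl)
      have e1' : eventsOn S₁ p tr = e1 := by
        rw [← eventsOn_filter h₁, he, List.filter_append,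
          filter_eq_self_of_registers h1 (hP p hp),
          filter_eq_nil_of_registers h2 (hd.symm.mono_left hfa), List.append_nil]
      have e2' : eventsOn S₂ p tr = e2 := by
        rw [← eventsOn_filter h₂, he, List.filter_append,
          filter_eq_self_of_registers h2 hfa,
          filter_eq_nil_of_registers h1 (hd.mono_left (hP p hp)), List.nil_append]
      exact ⟨.halt a, true, a, fun _ => ⟨e1' ▸ h1, by rw [e1', e2', he],
        fun _ => ⟨rfl, e2' ▸ h2⟩, by simp⟩⟩
  choose q b a hk using key
  have idle : ∀ {T : Set ρ}, T ⊆ S → ∀ p ∉ E, eventsOn T p tr = [] := by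
    intro T hT p hp
    rw [← eventsOn_filter hT, h.idle p hp, List.filter_nil]
  refine ⟨q, {p ∈ E | b p = true}, a, Finset.filter_subset _ _,
    ⟨fun p hp => (hk p hp).1, idle h₁⟩, fun p hp => ?_, ⟨fun p hp => ?_, fun p hp => ?_⟩,
    fun p hp hp' => ((hk p hp).2.2.2 (by simpa [hp] using hp')).2, fun p hp => (hk p hp).2.1⟩
  · have := Finset.mem_filter.1 hp
    exact ((hk p this.1).2.2.1 this.2).1
  · have := Finset.mem_filter.1 hp
    exact ((hk p this.1).2.2.1 this.2).2
  · by_cases hE : p ∈ E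
    · exact ((hk p hE).2.2.2 (by simpa [hE] using hp)).1
    · exact idle h₂ p hE

/-- Execution of a procedure followed, if it fails, by another one. -/
theorem Exec.orElse {tr : List (ℕ × Event ρ)} {S S₁ S₂ : Set ρ} {E : Finset ℕ}
    {P rest : ℕ → Code ρ (Option ℕ)} {f : ℕ → Option ℕ → Code ρ (Option ℕ)} {off : ℕ}
    {Q : ℕ → Code ρ (Option ℕ)}
    (h : Exec tr S E (fun p => (P p).bind (f p)) Q) (h₁ : S₁ ⊆ S) (h₂ : S₂ ⊆ S)
    (hd : Disjoint S₁ S₂) (hP : ∀ p ∈ E, (P p).registers ⊆ S₁)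
    (hr : ∀ p ∈ E, (rest p).registers ⊆ S₂)
    (hsome : ∀ p w, f p (some w) = .halt (some (off + w))) (hnone : ∀ p, f p none = rest p) :
    ∃ (Q₁ : ℕ → Code ρ (Option ℕ)) (E₂ : Finset ℕ), E₂ ⊆ E ∧ Exec tr S₁ E P Q₁ ∧
      (∀ p ∈ E₂, Q₁ p = .halt none) ∧ Exec tr S₂ E₂ rest Q ∧
      (∀ p ∈ E, p ∉ E₂ → ∀ b, Q p = .halt b → ∃ w, b = some (off + w) ∧ Q₁ p = .halt (some w)) ∧
      ∀ p ∈ E, eventsOn S p tr = eventsOn S₁ p tr ++ eventsOn S₂ p tr := by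
  classical
  have hf : ∀ p ∈ E, ∀ a ∈ (P p).results, (f p a).registers ⊆ S₂ := by
    rintro p hp (_ | w) _
    · rw [hnone]
      exact hr p hp
    · rw [hsome]
      exact empty_subset _
  obtain ⟨Q₁, E₂, A, hE, g1, g2, g3, g4, g5⟩ := h.bind h₁ h₂ hd hP hf
  -- Only failed processes enter `rest`; successful ones halt at once and leave no event on `S₂`.
  refine ⟨Q₁, {p ∈ E₂ | A p = none}, (Finset.filter_subset _ _).trans hE, g1, fun p hp => ?_,
    ⟨fun p hp => ?_, fun p hp => ?_⟩, fun p hp hp' b hb => ?_, g5⟩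
  · have := Finset.mem_filter.1 hp
    rw [g2 p this.1, this.2]
  · have := Finset.mem_filter.1 hp
    have := this.2 ▸ g3.path p this.1
    rwa [hnone] at this
  · by_cases hp2 : p ∈ E₂
    · have hA : A p ≠ none := by simpa [hp2] using hp
      obtain ⟨w, hw⟩ := Option.ne_none_iff_exists'.1 hA
      have := g3.path p hp2
      rw [hw, hsome] at this
      exact this.of_halt.1
    · exact g3.idle p hp2
  · by_cases hp2 : p ∈ E₂
    · have hA : A p ≠ none := by simpa [hp2] using hp'
      obtain ⟨w, hw⟩ := Option.ne_none_iff_exists'.1 hA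
      have := g3.path p hp2
      rw [hw, hsome] at this
      have := this.of_halt.2
      rw [hb] at this
      cases this
      exact ⟨w, rfl, by rw [g2 p hp2, hw]⟩
    · exact absurd hb (g4 p hp hp2 b)

/-! ### Competing for a register -/

/-- The output pins down the local history: one pattern for a win, three for a loss. The concurrent
arguments use only these patterns. -/
theorem compete_path {R H : ρ} {a : ℕ} {es : List (Event ρ)} {Q : Code ρ Bool}
    (h : Path (compete R H a) es Q) :
    (∀ r v, Event.wr r v ∈ es → v = a) ∧
    (Q = .halt true → es = [.rd H none, .wr H a, .rd R none, .wr R a, .rd H (some a)]) ∧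
    (Q = .halt false → (∃ v, es = [.rd H (some v)]) ∨
      (∃ v, es = [.rd H none, .wr H a, .rd R (some v)]) ∨
      ∃ c, c ≠ some a ∧ es = [.rd H none, .wr H a, .rd R none, .wr R a, .rd H c]) ∧
    es.length ≤ 5 := by
  unfold compete at h
  cases h with
  | nil => simp
  | read c h =>
  beta_reduce at h
  split_ifs at h with hc
  swap
  · obtain ⟨rfl, rfl⟩ := h.of_halt
    obtain ⟨v, rfl⟩ := Option.ne_none_iff_exists'.1 hc
    simp
  subst hc
  cases h with
  | nil => simp
  | write h =>
  cases h with
  | nil => simp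
  | read c h =>
  beta_reduce at h
  split_ifs at h with hc
  swap
  · obtain ⟨rfl, rfl⟩ := h.of_halt
    obtain ⟨v, rfl⟩ := Option.ne_none_iff_exists'.1 hc
    simp
  subst hc
  cases h with
  | nil => simp
  | write h =>
  cases h with
  | nil => simp +contextual [or_imp]
  | read c h =>
  obtain ⟨rfl, rfl⟩ := h.of_halt
  by_cases hc : c = some a <;> simp +contextual [hc, or_imp]

theorem compete_registers (R H : ρ) (a : ℕ) : (compete R H a).registers ⊆ {R, H} := by
  intro x hx
  simp only [compete, Code.registers, mem_union, mem_iUnion, mem_singleton_iff] at hx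
  rcases hx with rfl | ⟨c, hx⟩
  · simp
  split_ifs at hx
  swap
  · simp [Code.registers] at hx
  simp only [Code.registers, mem_union, mem_iUnion, mem_singleton_iff] at hx
  rcases hx with rfl | rfl | ⟨c, hx⟩
  · simp
  · simp
  split_ifs at hx
  swap
  · simp [Code.registers] at hx
  simp [Code.registers] at hx
  rcases hx with rfl | rfl <;> simp

/-- At most one process wins a register. -/
theorem compete_exclusive [DecidableEq ρ] {tr : List (ℕ × Event ρ)} (hv : Valid tr) {R H : ρ}
    (hRH : R ≠ H) {E : Finset ℕ} {nm : ℕ → ℕ} (hinj : InjOn nm E) {Q : ℕ → Code ρ Bool}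
    (h : Exec tr {R, H} E (fun p => compete R H (nm p)) Q) {p q : ℕ} (hp : p ∈ E) (hq : q ∈ E)
    (hQp : Q p = .halt true) (hQq : Q q = .halt true) : p = q := by
  -- Names are distinct and each process writes only its own, so the value seen in the last read
  -- comes from the winner's single write to `H`, and `H` is not written in between.
  have main : ∀ p ∈ E, Q p = .halt true → ∃ i₂ i₃ i₄ i₅ : ℕ, i₂ < i₃ ∧ i₄ < i₅ ∧
      tr[i₂]? = some (p, Event.wr H (nm p)) ∧ tr[i₃]? = some (p, Event.rd R none) ∧
      tr[i₄]? = some (p, Event.wr R (nm p)) ∧ tr[i₅]? = some (p, Event.rd H (some (nm p))) ∧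
      ∀ l, i₂ < l → l < i₅ → ∀ q w : ℕ, tr[l]? ≠ some (q, Event.wr H w) := by
    intro p hp hQ
    have hes := (compete_path (h.path p hp)).2.1 hQ
    obtain ⟨f, hf⟩ := eventsOn_embedding {R, H} p tr
    rw [hes] at hf
    have g2 := hf 1 _ rfl
    have g3 := hf 2 _ rfl
    have g4 := hf 3 _ rfl
    have g5 := hf 4 _ rfl
    refine ⟨f 1, f 2, f 3, f 4, by simp, by simp, g2, g3, g4, g5, ?_⟩
    obtain ⟨j, q, hj, hjq, hl⟩ := hv.last_write g5
    have hqm : Event.wr H (nm p) ∈ eventsOn {R, H} q tr :=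
      mem_eventsOn.2 ⟨List.mem_of_getElem? hjq, by simp [Event.reg]⟩
    have hqE : q ∈ E := by
      by_contra hqE
      rw [h.idle q hqE] at hqm
      cases hqm
    have hqp : p = q := hinj hp hqE ((compete_path (h.path q hqE)).1 _ _ hqm)
    subst hqp
    have : j = f 1 := by
      refine index_unique (S := {R, H}) (by simp [Event.reg]) ?_ hjq g2
      rw [hes]
      simp [hRH, Ne.symm hRH]
    exact this ▸ hl
  by_contra hpq
  obtain ⟨i₂, i₃, i₄, i₅, a1, a2, a3, a4, a5, a6, a7⟩ := main p hp hQp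
  obtain ⟨j₂, j₃, j₄, j₅, b1, b2, b3, b4, b5, b6, b7⟩ := main q hq hQq
  wlog hlt : i₂ < j₂ generalizing p q i₂ i₃ i₄ i₅ j₂ j₃ j₄ j₅
  · rcases lt_trichotomy i₂ j₂ with h1 | h1 | h1
    · exact hlt h1
    · rw [h1, b3] at a3
      simp at a3
      exact hpq a3.1.symm
    · exact this hq hp hQq hQp (Ne.symm hpq) _ _ _ _ b1 b2 b3 b4 b5 b6 b7 _ _ _ _ a1 a2 a3 a4 a5
        a6 a7 h1
  -- The write of `q` to `H` cannot fall between the write of `p` to `H` and its confirming read. So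
  -- `p` has written `R` before `q` reads it as `null`, a contradiction.
  have h5 : i₅ ≤ j₂ := by
    by_contra h5
    exact a7 j₂ hlt (by omega) _ _ b3
  exact hv.not_written b4 (by omega : i₄ < j₃) _ _ a5

/-- A process that competes alone does not lose. -/
theorem compete_alone [DecidableEq ρ] {tr : List (ℕ × Event ρ)} (hv : Valid tr) {R H : ρ}
    (hRH : R ≠ H) {p a : ℕ} {Q : Code ρ Bool} (h : Path (compete R H a) (eventsOn {R, H} p tr) Q)
    (hidle : ∀ q, q ≠ p → eventsOn {R, H} q tr = []) : Q ≠ .halt false := by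
  intro hQ
  obtain ⟨f, hf⟩ := eventsOn_embedding {R, H} p tr
  -- Any non-null value read from either register was written by `p` itself; each of the three
  -- losing patterns contradicts this or the absence of interfering writes.
  have hw : ∀ {i s : ℕ} {r : ρ} {v : ℕ}, tr[i]? = some (s, Event.rd r (some v)) → (r = R ∨ r = H) →
      Event.wr r v ∈ eventsOn {R, H} p tr := by
    intro i s r v hi hr
    obtain ⟨j, q, _, hjq, _⟩ := hv.last_write hi
    have hqm : Event.wr r v ∈ eventsOn {R, H} q tr :=
      mem_eventsOn.2 ⟨List.mem_of_getElem? hjq, by simpa [Event.reg] using hr⟩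
    by_cases hq : q = p
    · exact hq ▸ hqm
    · rw [hidle q hq] at hqm
      cases hqm
  have hws := (compete_path h).1
  rcases (compete_path h).2.2.1 hQ with ⟨v, hes⟩ | ⟨v, hes⟩ | ⟨c, hc, hes⟩
  · rw [hes] at hf
    have := hw (hf 0 _ rfl) (.inr rfl)
    rw [hes] at this
    simp at this
  · rw [hes] at hf
    have := hw (hf 2 _ rfl) (.inl rfl)
    rw [hes] at this
    simp [hRH] at this
  · rw [hes] at hf
    rcases c with _ | v
    · exact hv.not_written (hf 4 _ rfl) (by simp : f 1 < f 4) _ _ (hf 1 _ rfl)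
    · exact hc (congrArg some (hws _ _ (hw (hf 4 _ rfl) (.inr rfl))))

end Traces

/-! ### The length of executions -/

section Length

variable {ρ α β : Type}

/-- Every execution of the code has at most `d` steps. -/
def Code.LengthLE (P : Code ρ α) (d : ℕ) : Prop :=
  ∀ es Q, Path P es Q → es.length ≤ d

theorem Code.LengthLE.bind {P : Code ρ α} {f : α → Code ρ β} {d₁ d₂ : ℕ} (h₁ : P.LengthLE d₁)
    (h₂ : ∀ a ∈ P.results, (f a).LengthLE d₂) : (P.bind f).LengthLE (d₁ + d₂) := by
  intro es Q h
  rcases h.bind_cases with ⟨P', h, _⟩ | ⟨a, e1, e2, rfl, h, h'⟩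
  · exact (h₁ _ _ h).trans (Nat.le_add_right _ _)
  · rw [List.length_append]
    exact add_le_add (h₁ _ _ h) (h₂ a (h.result_mem rfl) _ _ h')

theorem Code.LengthLE.halt (a : α) (d : ℕ) : (Code.halt a : Code ρ α).LengthLE d := by
  intro es Q h
  simp [h.of_halt.1]

end Length

/-! ### Competing along a list of registers -/

section CompeteAlong

variable {ρ : Type} {R H : ℕ → ρ}

theorem competeAlong_registers (a : ℕ) (l : List ℕ) :
    (competeAlong R H a l).registers ⊆ ⋃ w ∈ l, {R w, H w} := by
  induction l with
  | nil => exact empty_subset _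
  | cons w ws ih =>
    refine (Code.registers_bind _ _).trans (union_subset ?_ (iUnion₂_subset fun b _ => ?_))
    · exact (compete_registers _ _ _).trans (subset_iUnion₂_of_subset w (by simp) subset_rfl)
    · cases b
      · exact ih.trans (biUnion_subset_biUnion_left fun x hx => List.mem_cons_of_mem _ hx)
      · exact empty_subset _

theorem competeAlong_results (a : ℕ) (l : List ℕ) :
    ∀ w, some w ∈ (competeAlong R H a l).results → w ∈ l := by
  induction l with
  | nil => rintro w ⟨⟩
  | cons w ws ih =>
    intro x hx
    obtain ⟨b, _, hb⟩ := mem_iUnion₂.1 (Code.results_bind _ _ hx)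
    cases b
    · exact List.mem_cons_of_mem _ (ih x hb)
    · cases hb
      exact List.mem_cons_self

theorem competeAlong_length (a : ℕ) (l : List ℕ) :
    (competeAlong R H a l).LengthLE (5 * l.length) := by
  induction l with
  | nil => exact .halt _ _
  | cons w ws ih =>
    rw [List.length_cons, mul_add, mul_one, add_comm]
    refine .bind (fun es Q h => (compete_path h).2.2.2) fun b _ => ?_
    cases b
    · exact ih
    · exact .halt _ _

open Classical in
-- As the list has no repetitions, the registers of `w` are touched in a single competition, which
-- can also be one not yet begun or never reached. Failing overall means having lost at every node.
theorem competeAlong_path (hd : ∀ w w', w ≠ w' → Disjoint ({R w, H w} : Set ρ) {R w', H w'})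
    {a : ℕ} {l : List ℕ} (hl : l.Nodup) {es : List (Event ρ)} {Q : Code ρ (Option ℕ)}
    (h : Path (competeAlong R H a l) es Q) {w : ℕ} (hw : w ∈ l) :
    ∃ Q', Path (compete (R w) (H w) a)
        (es.filter fun e => e.reg ∈ ({R w, H w} : Set ρ)) Q' ∧
      (Q = .halt (some w) → Q' = .halt true) ∧ (Q = .halt none → Q' = .halt false) := by
  induction l generalizing es with
  | nil => cases hw
  | cons v ws ih =>
    rw [List.nodup_cons] at hl
    have hself : ∀ {es Q}, Path (compete (R v) (H v) a) es Q →
        es.filter (fun e => e.reg ∈ ({R v, H v} : Set ρ)) = es := fun h =>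
      filter_eq_self_of_registers h (compete_registers _ _ _)
    have hother : ∀ {es Q}, Path (compete (R v) (H v) a) es Q → w ≠ v →
        es.filter (fun e => e.reg ∈ ({R w, H w} : Set ρ)) = [] := fun h hwv =>
      filter_eq_nil_of_registers h ((hd v w hwv.symm).mono_left (compete_registers _ _ _))
    have hrest : ∀ {es Q}, Path (competeAlong R H a ws) es Q →
        es.filter (fun e => e.reg ∈ ({R v, H v} : Set ρ)) = [] := by
      intro es Q h
      refine filter_eq_nil_of_registers h (Disjoint.mono_left (competeAlong_registers _ _) ?_)
      simp only [disjoint_iUnion_left]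
      exact fun x hx => hd x v fun hxv => hl.1 (hxv ▸ hx)
    rcases h.bind_cases with ⟨P', h1, h2⟩ | ⟨b, e1, e2, rfl, h1, h2⟩
    · by_cases hwv : w = v
      · subst hwv
        exact ⟨P', by rwa [hself h1], fun h => absurd h (h2 _), fun h => absurd h (h2 _)⟩
      · exact ⟨_, by rw [hother h1 hwv]; exact .nil _, fun h => absurd h (h2 _),
          fun h => absurd h (h2 _)⟩
    · rw [List.filter_append]
      cases b
      · by_cases hwv : w = v
        · subst hwv
          refine ⟨.halt false, by rwa [hself h1, hrest h2, List.append_nil], fun h => ?_,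
            fun _ => rfl⟩
          exact absurd (competeAlong_results _ _ _ (Path.result_mem h2 h)) hl.1
        · rw [hother h1 hwv, List.nil_append]
          exact ih hl.2 h2 ((List.mem_cons.1 hw).resolve_left hwv)
      · obtain ⟨rfl, rfl⟩ := Path.of_halt h2
        by_cases hwv : w = v
        · subst hwv
          exact ⟨.halt true, by rwa [hself h1, List.filter_nil, List.append_nil], fun _ => rfl,
            by simp⟩
        · exact ⟨_, by rw [hother h1 hwv]; exact .nil _, by simp [Ne.symm hwv], by simp⟩

variable {tr : List (ℕ × Event ρ)} {S : Set ρ} {E : Finset ℕ} {nm : ℕ → ℕ} {Γ : ℕ → List ℕ}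
  {Q : ℕ → Code ρ (Option ℕ)}

/-- Isolates the contest at one node: its potential contenders are the processes adjacent to it, at
whatever point of their lists it stands. -/
theorem competeAlong_exec (hd : ∀ w w', w ≠ w' → Disjoint ({R w, H w} : Set ρ) {R w', H w'})
    (hl : ∀ p ∈ E, (Γ (nm p)).Nodup)
    (h : Exec tr S E (fun p => competeAlong R H (nm p) (Γ (nm p))) Q) {w : ℕ}
    (hw : {R w, H w} ⊆ S) :
    ∃ Q' : ℕ → Code ρ Bool, Exec tr {R w, H w} {p ∈ E | w ∈ Γ (nm p)}
        (fun p => compete (R w) (H w) (nm p)) Q' ∧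
      ∀ p ∈ E, w ∈ Γ (nm p) →
        (Q p = .halt (some w) → Q' p = .halt true) ∧ (Q p = .halt none → Q' p = .halt false) := by
  classical
  have key : ∀ p, ∃ Q', p ∈ E ∧ w ∈ Γ (nm p) →
      Path (compete (R w) (H w) (nm p)) (eventsOn {R w, H w} p tr) Q' ∧
        (Q p = .halt (some w) → Q' = .halt true) ∧ (Q p = .halt none → Q' = .halt false) := by
    intro p
    by_cases hp : p ∈ E ∧ w ∈ Γ (nm p)
    · obtain ⟨Q', h'⟩ := competeAlong_path hd (hl p hp.1) (h.path p hp.1) hp.2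
      rw [eventsOn_filter hw] at h'
      exact ⟨Q', fun _ => h'⟩
    · exact ⟨.halt true, fun h => absurd h hp⟩
  choose Q' hQ' using key
  refine ⟨Q', ⟨fun p hp => (hQ' p (Finset.mem_filter.1 hp)).1, fun p hp => ?_⟩,
    fun p hp hpw => (hQ' p ⟨hp, hpw⟩).2⟩
  rw [← eventsOn_filter hw]
  by_cases hpE : p ∈ E
  · refine filter_eq_nil_of_registers (h.path p hpE)
      (Disjoint.mono_left (competeAlong_registers _ _) ?_)
    simp only [disjoint_iUnion_left]
    refine fun x hx => hd x w ?_
    rintro rfl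
    exact hp (Finset.mem_filter.2 ⟨hpE, hx⟩)
  · rw [h.idle p hpE, List.filter_nil]

theorem competeAlong_exclusive [DecidableEq ρ] (hv : Valid tr) (hRH : ∀ w, R w ≠ H w)
    (hd : ∀ w w', w ≠ w' → Disjoint ({R w, H w} : Set ρ) {R w', H w'}) (hinj : InjOn nm E)
    (hl : ∀ p ∈ E, (Γ (nm p)).Nodup) (hS : ∀ p ∈ E, ∀ w ∈ Γ (nm p), {R w, H w} ⊆ S)
    (h : Exec tr S E (fun p => competeAlong R H (nm p) (Γ (nm p))) Q) {p q w : ℕ} (hp : p ∈ E)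
    (hq : q ∈ E) (hQp : Q p = .halt (some w)) (hQq : Q q = .halt (some w)) : p = q := by
  have hpw : w ∈ Γ (nm p) := competeAlong_results _ _ _ ((h.path p hp).result_mem hQp)
  have hqw : w ∈ Γ (nm q) := competeAlong_results _ _ _ ((h.path q hq).result_mem hQq)
  obtain ⟨Q', h', hQ'⟩ := competeAlong_exec hd hl h (hS p hp w hpw)
  exact compete_exclusive hv (hRH w) (hinj.mono (Finset.filter_subset _ _)) h'
    (Finset.mem_filter.2 ⟨hp, hpw⟩) (Finset.mem_filter.2 ⟨hq, hqw⟩) ((hQ' p hp hpw).1 hQp)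
    ((hQ' q hq hqw).1 hQq)

/-- In an expanding set more than half of the vertices have neighbours of their own. -/
theorem two_mul_card_lt_of_expands {E F : Finset ℕ} {g : ℕ → Finset ℕ} {Δ : ℕ} (hF : F ⊆ E)
    (hdeg : ∀ p ∈ E, (g p).card = Δ) (hexp : 3 * E.card * Δ < 4 * (E.biUnion g).card)
    (hun : ∀ p ∈ E, ∀ w ∈ g p, (∀ q ∈ E, w ∈ g q → q = p) → p ∉ F) : 2 * F.card < E.card := by
  classical
  set N := E.biUnion g with hN
  let d : ℕ → ℕ := fun w => {p ∈ E | w ∈ g p}.card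
  let U := {w ∈ N | d w = 1}
  have hsum : ∑ w ∈ N, d w = E.card * Δ := by
    have := Finset.sum_card_bipartiteAbove_eq_sum_card_bipartiteBelow (s := N) (t := E)
      (fun w p => w ∈ g p)
    simp only [Finset.bipartiteAbove, Finset.bipartiteBelow] at this
    change ∑ w ∈ N, {p ∈ E | w ∈ g p}.card = _
    rw [this, ← smul_eq_mul, ← Finset.sum_const]
    refine Finset.sum_congr rfl fun p hp => ?_
    rw [← hdeg p hp]
    congr 1
    ext w
    simp only [Finset.mem_filter, hN, Finset.mem_biUnion]
    exact ⟨fun h => h.2, fun h => ⟨⟨p, hp, h⟩, h⟩⟩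
  have hpos : ∀ w ∈ N, 1 ≤ d w := by
    intro w hw
    obtain ⟨p, hp, hpw⟩ := Finset.mem_biUnion.1 hw
    exact Finset.card_pos.2 ⟨p, Finset.mem_filter.2 ⟨hp, hpw⟩⟩
  -- Every neighbour outside `U` absorbs at least two of the `|E|Δ` edges.
  have h1 : 2 * N.card ≤ E.card * Δ + U.card := by
    have : ∑ w ∈ N, 2 ≤ ∑ w ∈ N, (d w + if d w = 1 then 1 else 0) := by
      refine Finset.sum_le_sum fun w hw => ?_
      have := hpos w hw
      split_ifs <;> omega
    rw [Finset.sum_add_distrib, hsum, ← Finset.card_filter, Finset.sum_const, smul_eq_mul] at this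
    change _ ≤ _ + U.card at this
    linarith
  have h2 : U ⊆ (E \ F).biUnion g := by
    intro w hw
    obtain ⟨hwN, hw1⟩ := Finset.mem_filter.1 hw
    obtain ⟨p, hp⟩ := Finset.card_eq_one.1 hw1
    have hpm : p ∈ ({p ∈ E | w ∈ g p} : Finset ℕ) := by
      rw [hp]
      exact Finset.mem_singleton_self p
    obtain ⟨hpE, hpw⟩ := Finset.mem_filter.1 hpm
    refine Finset.mem_biUnion.2 ⟨p, Finset.mem_sdiff.2 ⟨hpE, hun p hpE w hpw fun q hq hqw => ?_⟩,
      hpw⟩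
    have : q ∈ ({p ∈ E | w ∈ g p} : Finset ℕ) := Finset.mem_filter.2 ⟨hq, hqw⟩
    rw [hp] at this
    exact Finset.mem_singleton.1 this
  have h3 : U.card ≤ (E.card - F.card) * Δ := by
    rw [← Finset.card_sdiff_of_subset hF]
    exact (Finset.card_le_card h2).trans (Finset.card_biUnion_le_card_mul _ _ _ fun p hp =>
      (hdeg p (Finset.sdiff_subset hp)).le)
  have hFE := Finset.card_le_card hF
  obtain ⟨c, hc⟩ := Nat.exists_eq_add_of_le hFE
  rw [hc, Nat.add_sub_cancel_left] at h3
  rw [hc] at h1 hexp ⊢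
  -- Expansion and `h1` give `|U| > |E|Δ/2`, whereas `h3` gives `|U| ≤ |E \ F|Δ`; hence `|E \ F| >
  -- |E|/2`.
  by_contra hcon
  have : c ≤ F.card := by omega
  nlinarith [Nat.mul_le_mul_right Δ this]

/-- A failing process has lost at all its nodes, so by `compete_alone` none of them is adjacent to
it alone; the edge count for expanding sets then applies. -/
theorem competeAlong_majority [DecidableEq ρ] (hv : Valid tr) (hRH : ∀ w, R w ≠ H w)
    (hd : ∀ w w', w ≠ w' → Disjoint ({R w, H w} : Set ρ) {R w', H w'}) (hinj : InjOn nm E)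
    (hS : ∀ p ∈ E, ∀ w ∈ Γ (nm p), {R w, H w} ⊆ S) {V W L Δ : ℕ}
    (hΓ : IsLosslessExpander V W L Δ (1 / 4) Γ) (hnm : ∀ p ∈ E, nm p ∈ Finset.Icc 1 V)
    (h : Exec tr S E (fun p => competeAlong R H (nm p) (Γ (nm p))) Q) (hE : E.Nonempty)
    (hL : E.card ≤ L) {F : Finset ℕ} (hF : F ⊆ E) (hQ : ∀ p ∈ F, Q p = .halt none) :
    2 * F.card < E.card := by
  have hl : ∀ p ∈ E, (Γ (nm p)).Nodup := fun p hp => hΓ.nodup _ (hnm p hp)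
  refine two_mul_card_lt_of_expands (g := fun p => (Γ (nm p)).toFinset) (Δ := Δ) hF ?_ ?_ ?_
  · intro p hp
    rw [List.toFinset_card_of_nodup (hl p hp), hΓ.degree _ (hnm p hp)]
  · have := hΓ.expands (E.image nm) (Finset.image_subset_iff.2 hnm) (hE.image nm)
      (Finset.card_image_le.trans hL)
    rw [Finset.card_image_of_injOn hinj, Finset.image_biUnion] at this
    have h' : (3 * E.card * Δ : ℝ) < 4 * ((E.biUnion fun p => (Γ (nm p)).toFinset).card : ℝ) := by
      linarith
    exact_mod_cast h'
  · intro p hp w hw hun hpF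
    rw [List.mem_toFinset] at hw
    obtain ⟨Q', h', hQ'⟩ := competeAlong_exec hd hl h (hS p hp w hw)
    refine compete_alone hv (hRH w) (h'.path p (Finset.mem_filter.2 ⟨hp, hw⟩)) (fun q hq => ?_)
      ((hQ' p hp hw).2 (hQ p hpF))
    refine h'.idle q fun hqm => hq ?_
    obtain ⟨hqE, hqw⟩ := Finset.mem_filter.1 hqm
    exact hun q hqE (List.mem_toFinset.2 hqw)

end CompeteAlong

/-! ### The stages of the algorithm -/

/-- The condition for running an epoch is stronger than what the graphs need, since 768 > 200 and
every stage has `L ≤ 2 ^ i`. -/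
theorem isExpander_stage (G : ExpanderFamily) {i N s : ℕ} (hN : 768 * Real.exp 4 * 2 ^ i < N)
    (hs : s ≤ i) : IsLosslessExpander N (outSize (2 ^ i / 2 ^ s) N) (2 ^ i / 2 ^ s)
      (inDegree (2 ^ i / 2 ^ s) N) (1 / 4) (G.nbr (2 ^ i / 2 ^ s) N) := by
  have he := Real.exp_pos 4
  refine G.isExpander _ _ (Nat.div_pos (Nat.pow_le_pow_right two_pos hs) (by positivity)) ?_
  rw [le_div_iff₀ (by positivity)]
  have h1 : ((2 ^ i / 2 ^ s : ℕ) : ℝ) ≤ 2 ^ i := by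
    exact_mod_cast Nat.div_le_self _ _
  nlinarith [mul_le_mul_of_nonneg_right h1 he.le, pow_pos (two_pos (α := ℝ)) i,
    mul_pos he (pow_pos (two_pos (α := ℝ)) i)]

theorem majority_registers (G : ExpanderFamily) (i t s L N p : ℕ) :
    (majority G i t s L N p).registers ⊆
      {r | r.phase = i ∧ r.epoch = t ∧ r.stage = s ∧ r.node ∈ G.nbr L N p} := by
  refine (competeAlong_registers _ _).trans (iUnion₂_subset fun w hw => ?_)
  rintro r (rfl | rfl) <;> exact ⟨rfl, rfl, rfl, hw⟩

/-- The registers of the stages `s, …, i` of Basic-Rename`(2 ^ i, N)`. -/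
def stageRegisters (i t N s : ℕ) : Set Register :=
  {r | r.phase = i ∧ r.epoch = t ∧ s ≤ r.stage ∧ r.stage ≤ i ∧
    r.node ∈ Icc 1 (outSize (2 ^ i / 2 ^ r.stage) N)}

/-- The registers of stage `s` of Basic-Rename`(2 ^ i, N)`. -/
def majorityRegisters (i t N s : ℕ) : Set Register :=
  {r | r.phase = i ∧ r.epoch = t ∧ r.stage = s ∧
    r.node ∈ Icc 1 (outSize (2 ^ i / 2 ^ r.stage) N)}

section Basic

variable {G : ExpanderFamily} {i t N : ℕ}

theorem majority_registers_subset (hN : 768 * Real.exp 4 * 2 ^ i < N) {s p : ℕ} (hs : s ≤ i)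
    (hp : p ∈ Finset.Icc 1 N) :
    (majority G i t s (2 ^ i / 2 ^ s) N p).registers ⊆ majorityRegisters i t N s := by
  refine (majority_registers _ _ _ _ _ _ _).trans ?_
  rintro r ⟨h1, h2, rfl, h4⟩
  exact ⟨h1, h2, rfl, by simpa using (isExpander_stage G hN hs).outputs p hp _ h4⟩

theorem majority_results (hN : 768 * Real.exp 4 * 2 ^ i < N) {s p w : ℕ} (hs : s ≤ i)
    (hp : p ∈ Finset.Icc 1 N)
    (hw : some w ∈ (majority G i t s (2 ^ i / 2 ^ s) N p).results) :
    1 ≤ w ∧ w ≤ outSize (2 ^ i / 2 ^ s) N :=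
  Finset.mem_Icc.1 ((isExpander_stage G hN hs).outputs p hp w (competeAlong_results _ _ w hw))

theorem basicStages_registers (hN : 768 * Real.exp 4 * 2 ^ i < N) {p : ℕ}
    (hp : p ∈ Finset.Icc 1 N) (m : ℕ) : ∀ s, s + m = i + 1 →
    (basicStages G i t N p (List.range' s m)).registers ⊆ stageRegisters i t N s := by
  induction m with
  | zero => exact fun s _ => empty_subset _
  | succ m ih =>
    intro s hs
    refine (Code.registers_bind _ _).trans (union_subset ?_ (iUnion₂_subset fun a _ => ?_))
    · refine (majority_registers_subset hN (by omega) hp).trans ?_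
      rintro r ⟨h1, h2, rfl, h4⟩
      exact ⟨h1, h2, le_rfl, by omega, h4⟩
    · rcases a with _ | w
      · refine (ih (s + 1) (by omega)).trans ?_
        rintro r ⟨h1, h2, h3, h4⟩
        exact ⟨h1, h2, by omega, h4⟩
      · exact empty_subset _

theorem stageOffset_succ (i N s : ℕ) :
    stageOffset i N (s + 1) = stageOffset i N s + outSize (2 ^ i / 2 ^ s) N :=
  Finset.sum_range_succ _ _

theorem stageOffset_mono (i N : ℕ) : Monotone (stageOffset i N) :=
  monotone_nat_of_le_succ fun s => by simp [stageOffset_succ]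

theorem basicStages_results (hN : 768 * Real.exp 4 * 2 ^ i < N) {p x : ℕ}
    (hp : p ∈ Finset.Icc 1 N) (m : ℕ) : ∀ s, s + m = i + 1 →
    some x ∈ (basicStages G i t N p (List.range' s m)).results →
      stageOffset i N s < x ∧ x ≤ basicRange i N := by
  induction m with
  | zero => rintro s _ ⟨⟩
  | succ m ih =>
    intro s hs hx
    have hsucc := stageOffset_succ i N s
    obtain ⟨a, ha, hax⟩ := mem_iUnion₂.1 (Code.results_bind _ _ hx)
    rcases a with _ | w
    · have := ih (s + 1) (by omega) hax
      omega
    · cases hax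
      have hle : stageOffset i N (s + 1) ≤ basicRange i N := stageOffset_mono i N (by omega)
      have := majority_results hN (by omega) hp ha
      omega

/-- Fewer than half of the entrants of a stage go on, so the bound `2 ^ i / 2 ^ s` persists. Equal
names cannot come from different stages, whose name intervals are disjoint, nor from one stage by
`competeAlong_exclusive`. -/
theorem basicStages_exec (hN : 768 * Real.exp 4 * 2 ^ i < N) {tr : List (ℕ × Event Register)}
    (hv : Valid tr) {nm : ℕ → ℕ} (m : ℕ) :
    ∀ (s : ℕ) (E : Finset ℕ) (Q : ℕ → Code Register (Option ℕ)), s + m = i + 1 → InjOn nm E →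
      (∀ p ∈ E, nm p ∈ Finset.Icc 1 N) →
      Exec tr (stageRegisters i t N s) E
        (fun p => basicStages G i t N (nm p) (List.range' s m)) Q →
      (∀ p ∈ E, ∀ q ∈ E, ∀ x, Q p = .halt (some x) → Q q = .halt (some x) → p = q) ∧
        (E.card ≤ 2 ^ i / 2 ^ s → ∀ p ∈ E, Q p ≠ .halt none) := by
  induction m with
  | zero =>
    intro s E Q hs hinj hnm h
    have hQ : ∀ p ∈ E, Q p = .halt none := fun p hp => (h.path p hp).of_halt.2
    refine ⟨fun p hp q _ x hx => ?_, fun hE p hp => ?_⟩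
    · rw [hQ p hp] at hx
      cases hx
    -- Here `s = i + 1`, so the quotient is zero and nobody is left.
    · rw [Nat.div_eq_of_lt (Nat.pow_lt_pow_right (by norm_num) (by omega)), Nat.le_zero,
        Finset.card_eq_zero] at hE
      simp [hE] at hp
  | succ m ih =>
    intro s E Q hs hinj hnm h
    have hG := isExpander_stage G hN (by omega : s ≤ i)
    obtain ⟨Q₁, E₂, hE₂, h1, h2, h3, h4, -⟩ := h.orElse (S₁ := majorityRegisters i t N s)
      (S₂ := stageRegisters i t N (s + 1))
      (rest := fun p => basicStages G i t N (nm p) (List.range' (s + 1) m))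
      (off := stageOffset i N s)
      (by rintro r ⟨h1, h2, rfl, h4⟩
          exact ⟨h1, h2, le_rfl, by omega, h4⟩)
      (by rintro r ⟨h1, h2, h3, h4⟩
          exact ⟨h1, h2, by omega, h4⟩)
      (by rw [disjoint_left]
          rintro r ⟨_, _, h3, _⟩ ⟨_, _, h3', _⟩
          omega)
      (fun p hp => majority_registers_subset hN (by omega) (hnm p hp))
      (fun p hp => basicStages_registers hN (hnm p hp) m (s + 1) (by omega))
      (fun _ _ => rfl) (fun _ => rfl)
    have hRH : ∀ w, (⟨i, t, s, w, false⟩ : Register) ≠ ⟨i, t, s, w, true⟩ := by simp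
    have hd : ∀ w w', w ≠ w' → Disjoint ({⟨i, t, s, w, false⟩, ⟨i, t, s, w, true⟩} : Set Register)
        {⟨i, t, s, w', false⟩, ⟨i, t, s, w', true⟩} := by
      intro w w' hw
      simp [hw.symm]
    have hS : ∀ p ∈ E, ∀ w ∈ G.nbr (2 ^ i / 2 ^ s) N (nm p),
        ({⟨i, t, s, w, false⟩, ⟨i, t, s, w, true⟩} : Set Register) ⊆ majorityRegisters i t N s := by
      rintro p hp w hw r (rfl | rfl) <;>
        exact ⟨rfl, rfl, rfl, by simpa using hG.outputs _ (hnm p hp) w hw⟩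
    obtain ⟨ih1, ih2⟩ := ih (s + 1) E₂ Q (by omega) (hinj.mono hE₂) (fun p hp => hnm p (hE₂ hp)) h3
    have hlate : ∀ p ∈ E₂, ∀ x, Q p = .halt (some x) → stageOffset i N (s + 1) < x :=
      fun p hp x hx => (basicStages_results hN (hnm p (hE₂ hp)) m (s + 1) (by omega)
        ((h3.path p hp).result_mem hx)).1
    have hearly : ∀ p ∈ E, p ∉ E₂ → ∀ x, Q p = .halt (some x) → ∃ w, x = stageOffset i N s + w ∧
        x ≤ stageOffset i N (s + 1) ∧ Q₁ p = .halt (some w) := by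
      intro p hp hp2 x hx
      obtain ⟨w, hw, hQ⟩ := h4 p hp hp2 _ hx
      cases hw
      have := majority_results hN (by omega : s ≤ i) (hnm p hp) ((h1.path p hp).result_mem hQ)
      exact ⟨w, rfl, by rw [stageOffset_succ]; omega, hQ⟩
    refine ⟨fun p hp q hq x hpx hqx => ?_, fun hE p hp hQ => ?_⟩
    · by_cases hp2 : p ∈ E₂ <;> by_cases hq2 : q ∈ E₂
      · exact ih1 p hp2 q hq2 x hpx hqx
      · obtain ⟨w, _, hw, _⟩ := hearly q hq hq2 x hqx
        have := hlate p hp2 x hpx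
        omega
      · obtain ⟨w, _, hw, _⟩ := hearly p hp hp2 x hpx
        have := hlate q hq2 x hqx
        omega
      · obtain ⟨w, hw, _, hpw⟩ := hearly p hp hp2 x hpx
        obtain ⟨w', hw', _, hqw⟩ := hearly q hq hq2 x hqx
        obtain rfl : w = w' := by omega
        exact competeAlong_exclusive hv hRH hd hinj (fun p hp => hG.nodup _ (hnm p hp)) hS h1
          hp hq hpw hqw
    · by_cases hp2 : p ∈ E₂
      · have := competeAlong_majority hv hRH hd hinj hS hG hnm h1 ⟨p, hp⟩ hE hE₂ h2
        refine ih2 ?_ p hp2 hQ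
        rw [pow_succ, ← Nat.div_div_eq_div_mul]
        omega
      · obtain ⟨w, hw, _⟩ := h4 p hp hp2 _ hQ
        cases hw

end Basic

theorem basicRename_eq (G : ExpanderFamily) (i t N p : ℕ) :
    basicRename G i t N p = basicStages G i t N p (List.range' 0 (i + 1)) := by
  rw [basicRename, List.range_eq_range']

/-! ### The epochs -/

theorem lt_rangeAfter {i N t : ℕ} (ht : t < numEpochs i N) :
    768 * Real.exp 4 * 2 ^ i < rangeAfter i N t := by
  simpa using Nat.notMem_of_lt_sInf ht

/-- The registers of the first `T` epochs of PolyLog-Rename`(2 ^ i, N)`. -/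
def epochRegisters (i N T : ℕ) : Set Register :=
  {r | r.phase = i ∧ r.epoch < T ∧ r.stage ≤ i ∧
    r.node ∈ Icc 1 (outSize (2 ^ i / 2 ^ r.stage) (rangeAfter i N r.epoch))}

theorem stageRegisters_subset (i N t : ℕ) :
    stageRegisters i t (rangeAfter i N t) 0 ⊆ epochRegisters i N (t + 1) := by
  rintro r ⟨h1, rfl, -, h4, h5⟩
  exact ⟨h1, Nat.lt_succ_self _, h4, h5⟩

theorem epochRegisters_mono (i N : ℕ) : Monotone (epochRegisters i N) := by
  rintro T T' hT r ⟨h1, h2, h3⟩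
  exact ⟨h1, h2.trans_le hT, h3⟩

section PolyLog

variable {G : ExpanderFamily} {i N : ℕ}

theorem polyLogEpochs_results {p x : ℕ} (hp : p ∈ Finset.Icc 1 N) (t : ℕ) (ht : t ≤ numEpochs i N)
    (hx : some x ∈ (polyLogEpochs G i N p t).results) : x ∈ Finset.Icc 1 (rangeAfter i N t) := by
  induction t generalizing x with
  | zero =>
    cases hx
    exact hp
  | succ t ih =>
    obtain ⟨a, ha, hax⟩ := mem_iUnion₂.1 (Code.results_bind _ _ hx)
    rcases a with _ | q
    · cases hax
    · dsimp only at hax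
      rw [basicRename_eq] at hax
      have := basicStages_results (lt_rangeAfter ht) (ih (by omega) ha) _ 0 (by omega) hax
      rw [Finset.mem_Icc]
      exact ⟨by omega, this.2⟩

theorem polyLogEpochs_registers {p : ℕ} (hp : p ∈ Finset.Icc 1 N) (t : ℕ)
    (ht : t ≤ numEpochs i N) : (polyLogEpochs G i N p t).registers ⊆ epochRegisters i N t := by
  induction t with
  | zero => exact empty_subset _
  | succ t ih =>
    refine (Code.registers_bind _ _).trans (union_subset ?_ (iUnion₂_subset fun a ha => ?_))
    · exact (ih (by omega)).trans (epochRegisters_mono i N t.le_succ)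
    · rcases a with _ | q
      · exact empty_subset _
      · dsimp only
        rw [basicRename_eq]
        exact (basicStages_registers (lt_rangeAfter ht) (polyLogEpochs_results hp t (by omega) ha)
          _ 0 (by omega)).trans (stageRegisters_subset i N t)

/-- Exclusiveness of the names of one epoch supplies the injectivity of current names that the next
epoch requires. -/
theorem polyLogEpochs_exec {tr : List (ℕ × Event Register)} (hv : Valid tr) {E : Finset ℕ}
    (hE : E ⊆ Finset.Icc 1 N) (t : ℕ) : ∀ (Q : ℕ → Code Register (Option ℕ)),
    t ≤ numEpochs i N →
    Exec tr (epochRegisters i N t) E (fun p => polyLogEpochs G i N p t) Q →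
      (∀ p ∈ E, ∀ q ∈ E, ∀ x, Q p = .halt (some x) → Q q = .halt (some x) → p = q) ∧
        (E.card ≤ 2 ^ i → ∀ p ∈ E, Q p ≠ .halt none) := by
  classical
  induction t with
  | zero =>
    intro Q _ h
    have hQ : ∀ p ∈ E, Q p = .halt (some p) := fun p hp => (h.path p hp).of_halt.2
    refine ⟨fun p hp q hq x hpx hqx => ?_, fun _ p hp => by simp [hQ p hp]⟩
    rw [hQ p hp] at hpx
    rw [hQ q hq] at hqx
    cases hpx
    cases hqx
    rfl
  | succ t ih =>
    intro Q ht h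
    obtain ⟨Q₁, E₂, A, hE₂, h1, h2, h3, h4, -⟩ := h.bind (S₁ := epochRegisters i N t)
      (S₂ := stageRegisters i t (rangeAfter i N t) 0) (epochRegisters_mono i N t.le_succ)
      (stageRegisters_subset i N t)
      (by rw [disjoint_left]
          rintro r ⟨_, h3, _⟩ ⟨_, h3', _⟩
          omega)
      (fun p hp => polyLogEpochs_registers (hE hp) t (by omega))
      (by rintro p hp (_ | q) ha
          · exact empty_subset _
          · dsimp only
            rw [basicRename_eq]
            exact basicStages_registers (lt_rangeAfter ht)
              (polyLogEpochs_results (hE hp) t (by omega) ha) _ 0 (by omega))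
    obtain ⟨ih1, ih2⟩ := ih Q₁ (by omega) h1
    -- The default 0 is irrelevant: only names of processes in `E₃`, which obtained one, are used.
    let nm : ℕ → ℕ := fun p => (A p).getD 0
    let E₃ := {p ∈ E₂ | A p ≠ none}
    have hE₃ : ∀ p ∈ E₃, p ∈ E₂ ∧ A p = some (nm p) := by
      intro p hp
      obtain ⟨h1, h2⟩ := Finset.mem_filter.1 hp
      obtain ⟨w, hw⟩ := Option.ne_none_iff_exists'.1 h2
      exact ⟨h1, by simp [nm, hw]⟩
    have hnone : ∀ p ∈ E₂, p ∉ E₃ → A p = none := by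
      intro p hp hp3
      by_contra hA
      exact hp3 (Finset.mem_filter.2 ⟨hp, hA⟩)
    have hnonepath : ∀ p ∈ E₂, p ∉ E₃ →
        eventsOn (stageRegisters i t (rangeAfter i N t) 0) p tr = [] ∧ Q p = .halt none := by
      intro p hp hp3
      have := h3.path p hp
      rw [hnone p hp hp3] at this
      exact this.of_halt
    have h5 : Exec tr (stageRegisters i t (rangeAfter i N t) 0) E₃
        (fun p => basicStages G i t (rangeAfter i N t) (nm p) (List.range' 0 (i + 1))) Q := by
      refine ⟨fun p hp => ?_, fun p hp => ?_⟩
      · have := h3.path p (hE₃ p hp).1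
        rw [(hE₃ p hp).2] at this
        dsimp only at this
        rwa [basicRename_eq] at this
      · by_cases hp2 : p ∈ E₂
        · exact (hnonepath p hp2 hp).1
        · exact h3.idle p hp2
    have hQ₁ : ∀ p ∈ E₃, Q₁ p = .halt (some (nm p)) := by
      intro p hp
      rw [h2 p (hE₃ p hp).1, (hE₃ p hp).2]
    obtain ⟨g1, g2⟩ := basicStages_exec (lt_rangeAfter ht) hv (i + 1) 0 E₃ Q (by omega)
      (fun p hp q hq hpq => ih1 p (hE₂ (hE₃ p hp).1) q (hE₂ (hE₃ q hq).1) _ (hQ₁ p hp)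
        (by rw [hQ₁ q hq]; exact congrArg (fun x => Code.halt (some x)) hpq.symm))
      (fun p hp => polyLogEpochs_results (hE (hE₂ (hE₃ p hp).1)) t (by omega)
        ((h1.path p (hE₂ (hE₃ p hp).1)).result_mem (hQ₁ p hp))) h5
    have hin : ∀ p ∈ E, ∀ x, Q p = .halt (some x) → p ∈ E₃ := by
      intro p hp x hx
      by_contra hp3
      by_cases hp2 : p ∈ E₂
      · rw [(hnonepath p hp2 hp3).2] at hx
        cases hx
      · exact h4 p hp hp2 _ hx
    refine ⟨fun p hp q hq x hpx hqx => g1 p (hin p hp x hpx) q (hin q hq x hqx) x hpx hqx,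
      fun hcard p hp hQ => ?_⟩
    by_cases hp2 : p ∈ E₂
    · by_cases hp3 : p ∈ E₃
      · refine g2 ?_ p hp3 hQ
        rw [pow_zero, Nat.div_one]
        exact (Finset.card_le_card ((Finset.filter_subset _ _).trans hE₂)).trans hcard
      · refine ih2 hcard p hp ?_
        rw [h2 p hp2, hnone p hp2 hp3]
    · exact h4 p hp hp2 _ hQ

end PolyLog

/-! ### The number of steps -/

/-- A bound on the steps of Basic-Rename`(2 ^ i, N)`. -/
noncomputable def basicCost (i N : ℕ) : ℕ :=
  ∑ s ∈ Finset.range (i + 1), 5 * inDegree (2 ^ i / 2 ^ s) N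

/-- A bound on the steps of PolyLog-Rename`(2 ^ i, N)`. -/
noncomputable def polyLogCost (i N : ℕ) : ℕ :=
  ∑ t ∈ Finset.range (numEpochs i N), basicCost i (rangeAfter i N t)

theorem basicRename_length {G : ExpanderFamily} {i t N p : ℕ}
    (hN : 768 * Real.exp 4 * 2 ^ i < N) (hp : p ∈ Finset.Icc 1 N) :
    (basicRename G i t N p).LengthLE (basicCost i N) := by
  have key : ∀ m s, s + m = i + 1 → (basicStages G i t N p (List.range' s m)).LengthLE
      (∑ j ∈ Finset.Ico s (s + m), 5 * inDegree (2 ^ i / 2 ^ j) N) := by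
    intro m
    induction m with
    | zero => exact fun s _ => .halt _ _
    | succ m ih =>
      intro s hs
      rw [Finset.sum_eq_sum_Ico_succ_bot (by omega),
        ← (isExpander_stage G hN (by omega : s ≤ i)).degree p hp]
      refine .bind (competeAlong_length _ _) fun a _ => ?_
      rcases a with _ | w
      · have := ih (s + 1) (by omega)
        rwa [show s + 1 + m = s + (m + 1) by omega] at this
      · exact .halt _ _
  rw [basicRename_eq, basicCost, Finset.range_eq_Ico]
  simpa using key (i + 1) 0 (by omega)

theorem polyLogRename_length {G : ExpanderFamily} {i N p : ℕ} (hp : p ∈ Finset.Icc 1 N) :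
    (polyLogRename G i N p).LengthLE (polyLogCost i N) := by
  have key : ∀ T ≤ numEpochs i N, (polyLogEpochs G i N p T).LengthLE
      (∑ t ∈ Finset.range T, basicCost i (rangeAfter i N t)) := by
    intro T
    induction T with
    | zero => exact fun _ => .halt _ _
    | succ T ih =>
      intro hT
      rw [Finset.sum_range_succ]
      refine .bind (ih (by omega)) fun a ha => ?_
      rcases a with _ | q
      · exact .halt _ _
      · exact basicRename_length (lt_rangeAfter hT) (polyLogEpochs_results hp T (by omega) ha)
  exact key _ le_rfl

/-! ### The phases -/

/-- The registers of the phases `i, i + 1, …`, below `l`. -/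
def phaseRegisters (N i l : ℕ) : Set Register :=
  {r | i ≤ r.phase ∧ r.phase < l ∧ r.epoch < numEpochs r.phase N ∧ r.stage ≤ r.phase ∧
    r.node ∈ Icc 1 (outSize (2 ^ r.phase / 2 ^ r.stage) (rangeAfter r.phase N r.epoch))}

theorem epochRegisters_subset {N i l : ℕ} (h : i < l) :
    epochRegisters i N (numEpochs i N) ⊆ phaseRegisters N i l := by
  rintro r ⟨rfl, h2⟩
  exact ⟨le_rfl, h, h2⟩

theorem phaseRegisters_succ (N i l : ℕ) : phaseRegisters N (i + 1) l ⊆ phaseRegisters N i l := by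
  rintro r ⟨h1, h2⟩
  exact ⟨by omega, h2⟩

theorem phaseOffset_succ (N i : ℕ) :
    phaseOffset N (i + 1) = phaseOffset N i + rangeAfter i N (numEpochs i N) :=
  Finset.sum_range_succ _ _

theorem phaseOffset_mono (N : ℕ) : Monotone (phaseOffset N) :=
  monotone_nat_of_le_succ fun s => by simp [phaseOffset_succ]

section Phases

variable {G : ExpanderFamily} {N : ℕ}

theorem phases_registers {p : ℕ} (hp : p ∈ Finset.Icc 1 N) (m i : ℕ) :
    (phases G N p (List.range' i m)).registers ⊆ phaseRegisters N i (i + m) := by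
  induction m generalizing i with
  | zero => exact empty_subset _
  | succ m ih =>
    refine (Code.registers_bind _ _).trans (union_subset ?_ (iUnion₂_subset fun a ha => ?_))
    · exact (polyLogEpochs_registers hp _ le_rfl).trans (epochRegisters_subset (by omega))
    · rcases a with _ | q
      · refine (ih (i + 1)).trans ?_
        rw [show i + 1 + m = i + (m + 1) by omega]
        exact phaseRegisters_succ _ _ _
      · exact empty_subset _

theorem phases_results {p x : ℕ} (hp : p ∈ Finset.Icc 1 N) (m i : ℕ)
    (hx : some x ∈ (phases G N p (List.range' i m)).results) : phaseOffset N i < x := by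
  induction m generalizing i with
  | zero => cases hx
  | succ m ih =>
    obtain ⟨a, ha, hax⟩ := mem_iUnion₂.1 (Code.results_bind _ _ hx)
    rcases a with _ | q
    · have := ih (i + 1) hax
      rw [phaseOffset_succ] at this
      omega
    · cases hax
      have := Finset.mem_Icc.1 (polyLogEpochs_results hp _ le_rfl ha)
      omega

/-- A phase `j` with `|E| ≤ 2 ^ j` never fails, so no process goes beyond it. This bounds both the
names and the events by sums over phases up to `j`. -/
theorem phases_exec {tr : List (ℕ × Event Register)} (hv : Valid tr) (m : ℕ) :
    ∀ (i : ℕ) (E : Finset ℕ) (Q : ℕ → Code Register (Option ℕ)), E ⊆ Finset.Icc 1 N →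
      Exec tr (phaseRegisters N i (i + m)) E (fun p => phases G N p (List.range' i m)) Q →
      (∀ p ∈ E, ∀ q ∈ E, ∀ x, Q p = .halt (some x) → Q q = .halt (some x) → p = q) ∧
        ∀ j, i ≤ j → j < i + m → E.card ≤ 2 ^ j → ∀ p ∈ E,
          (∀ o, Q p = .halt o → ∃ x, o = some x ∧ x ≤ phaseOffset N (j + 1)) ∧
          (eventsOn (phaseRegisters N i (i + m)) p tr).length ≤
            ∑ l ∈ Finset.Ico i (j + 1), polyLogCost l N := by
  induction m with
  | zero =>
    intro i E Q hE h
    refine ⟨fun p hp q _ x hx => ?_, by omega⟩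
    rw [(h.path p hp).of_halt.2] at hx
    cases hx
  | succ m ih =>
    intro i E Q hE h
    have him : i + 1 + m = i + (m + 1) := by omega
    obtain ⟨Q₁, E₂, hE₂, h1, h2, h3, h4, h5⟩ := h.orElse
      (S₁ := epochRegisters i N (numEpochs i N)) (S₂ := phaseRegisters N (i + 1) (i + (m + 1)))
      (rest := fun p => phases G N p (List.range' (i + 1) m)) (off := phaseOffset N i)
      (epochRegisters_subset (by omega)) (phaseRegisters_succ _ _ _)
      (by rw [disjoint_left]
          rintro r ⟨_, _⟩ ⟨_, _⟩
          omega)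
      (fun p hp => polyLogEpochs_registers (hE hp) _ le_rfl)
      (fun p hp => him ▸ phases_registers (hE hp) m (i + 1))
      (fun _ _ => rfl) (fun _ => rfl)
    rw [← him] at h3
    obtain ⟨ih1, ih2⟩ := ih (i + 1) E₂ Q (hE₂.trans hE) h3
    obtain ⟨g1, g2⟩ := polyLogEpochs_exec hv hE _ Q₁ le_rfl h1
    have hlate : ∀ p ∈ E₂, ∀ x, Q p = .halt (some x) → phaseOffset N (i + 1) < x :=
      fun p hp x hx => phases_results (hE (hE₂ hp)) m (i + 1) ((h3.path p hp).result_mem hx)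
    have hearly : ∀ p ∈ E, p ∉ E₂ → ∀ o, Q p = .halt o → ∃ w x, o = some x ∧
        x = phaseOffset N i + w ∧ x ≤ phaseOffset N (i + 1) ∧ Q₁ p = .halt (some w) := by
      intro p hp hp2 o ho
      obtain ⟨w, hw, hQ⟩ := h4 p hp hp2 _ ho
      have := Finset.mem_Icc.1 (polyLogEpochs_results (hE hp) _ le_rfl
        ((h1.path p hp).result_mem hQ))
      exact ⟨w, _, hw, rfl, by rw [phaseOffset_succ]; omega, hQ⟩
    refine ⟨fun p hp q hq x hpx hqx => ?_, fun j hij hjm hcard p hp => ?_⟩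
    · by_cases hp2 : p ∈ E₂ <;> by_cases hq2 : q ∈ E₂
      · exact ih1 p hp2 q hq2 x hpx hqx
      · obtain ⟨w, _, ⟨⟩, _, hw, _⟩ := hearly q hq hq2 _ hqx
        have := hlate p hp2 x hpx
        omega
      · obtain ⟨w, _, ⟨⟩, _, hw, _⟩ := hearly p hp hp2 _ hpx
        have := hlate q hq2 x hqx
        omega
      · obtain ⟨w, _, ⟨⟩, hw, _, hpw⟩ := hearly p hp hp2 _ hpx
        obtain ⟨w', _, ⟨⟩, hw', _, hqw⟩ := hearly q hq hq2 _ hqx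
        obtain rfl : w = w' := by omega
        exact g1 p hp q hq w hpw hqw
    · have hlen : (eventsOn (epochRegisters i N (numEpochs i N)) p tr).length ≤
          polyLogCost i N := polyLogRename_length (hE hp) _ _ (h1.path p hp)
      rw [h5 p hp, List.length_append, Finset.sum_eq_sum_Ico_succ_bot (by omega)]
      by_cases hp2 : p ∈ E₂
      -- Members of `E₂` have failed in phase `i`, which phase `j` does not allow.
      · have hne : i ≠ j := by
          rintro rfl
          exact g2 hcard p hp (h2 p hp2)
        obtain ⟨k1, k2⟩ := ih2 j (by omega) (by omega)
          ((Finset.card_le_card hE₂).trans hcard) p hp2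
        rw [him] at k2
        exact ⟨k1, add_le_add hlen k2⟩
      · have hnil : eventsOn (phaseRegisters N (i + 1) (i + (m + 1))) p tr = [] := by
          rw [← him]
          exact h3.idle p hp2
        refine ⟨fun o ho => ?_, ?_⟩
        · obtain ⟨w, x, hx, _, hle, _⟩ := hearly p hp hp2 o ho
          exact ⟨x, hx, hle.trans (phaseOffset_mono N (by omega))⟩
        · rw [hnil, List.length_nil]
          exact add_le_add hlen (Nat.zero_le _)

/-- The executions of Almost-Adaptive`(N)`. -/
theorem almostAdaptive_run (G : ExpanderFamily) (n N : ℕ) {K : Finset ℕ}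
    (hK : K ⊆ Finset.Icc 1 N) {σ : List ℕ} (hσ : ∀ p ∈ σ, p ∈ K) :
    (∀ p ∈ K, ∀ q ∈ K, ∀ x, Acquired (almostAdaptive G n N) σ p x →
      Acquired (almostAdaptive G n N) σ q x → p = q) ∧
    ∀ p ∈ K, (∀ x, Acquired (almostAdaptive G n N) σ p x → 1 ≤ x) ∧
      ∀ j ≤ Nat.clog 2 n, K.card ≤ 2 ^ j →
        (∀ x, Acquired (almostAdaptive G n N) σ p x → x ≤ phaseOffset N (j + 1)) ∧
        (∑ l ∈ Finset.range (j + 1), polyLogCost l N < σ.count p →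
          ∃ x, Acquired (almostAdaptive G n N) σ p x) := by
  obtain ⟨tr, hv, -, hpath, htag, hcount⟩ := exists_trace (almostAdaptive G n N) σ
  have halg : ∀ p, almostAdaptive G n N p = phases G N p (List.range' 0 (Nat.clog 2 n + 1)) := by
    intro p
    rw [almostAdaptive, List.range_eq_range']
  have hself : ∀ p ∈ K, eventsOn (phaseRegisters N 0 (0 + (Nat.clog 2 n + 1))) p tr =
      eventsOn univ p tr := by
    classical
    intro p hp
    rw [← eventsOn_filter (subset_univ _)]
    refine filter_eq_self_of_registers (hpath p) ?_
    rw [halg]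
    exact phases_registers (hK hp) _ _
  have h : Exec tr (phaseRegisters N 0 (0 + (Nat.clog 2 n + 1))) K
      (fun p => phases G N p (List.range' 0 (Nat.clog 2 n + 1)))
      (run (almostAdaptive G n N) σ).code := by
    refine ⟨fun p hp => ?_, fun p hp => ?_⟩
    · rw [hself p hp, ← halg]
      exact hpath p
    · rw [List.eq_nil_iff_forall_not_mem]
      exact fun e he => hp (hσ _ (htag _ (mem_eventsOn.1 he).1))
  obtain ⟨h1, h2⟩ := phases_exec hv _ _ _ _ hK h
  refine ⟨h1, fun p hp => ⟨fun x hx => ?_, fun j hj hcard => ?_⟩⟩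
  · exact Nat.one_le_iff_ne_zero.2
      (Nat.ne_zero_of_lt (phases_results (hK hp) _ _ ((h.path p hp).result_mem hx)))
  · obtain ⟨g1, g2⟩ := h2 j (Nat.zero_le _) (by omega) hcard p hp
    refine ⟨fun x hx => ?_, fun hlt => ?_⟩
    · obtain ⟨y, hy, hle⟩ := g1 _ hx
      cases hy
      exact hle
    -- A process still running would have one event per turn, more than its phases permit.
    · rcases hcount p with ⟨o, ho⟩ | hlen
      · obtain ⟨x, rfl, _⟩ := g1 _ ho
        exact ⟨x, ho⟩
      · rw [hself p hp, hlen, ← Finset.range_eq_Ico] at g2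
        omega

end Phases

/-! ### Existence of lossless expanders -/

/-- A random Δ-subset of `[W]` lies in a fixed `y`-set with probability at most (y/W)^Δ: compare
(y-d)/(W-d) ≤ y/W factor by factor. -/
theorem choose_mul_pow_le (Δ : ℕ) {y W : ℕ} (h : y ≤ W) :
    y.choose Δ * W ^ Δ ≤ W.choose Δ * y ^ Δ := by
  have key : y.descFactorial Δ * W ^ Δ ≤ W.descFactorial Δ * y ^ Δ := by
    induction Δ with
    | zero => simp
    | succ d ih =>
      have : (y - d) * W ≤ (W - d) * y := by
        rcases le_total y d with hd | hd
        · simp [Nat.sub_eq_zero_of_le hd]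
        · zify [hd, hd.trans h]
          have : (y : ℤ) ≤ W := by exact_mod_cast h
          nlinarith
      calc y.descFactorial (d + 1) * W ^ (d + 1)
          = ((y - d) * W) * (y.descFactorial d * W ^ d) := by rw [Nat.descFactorial_succ]; ring
        _ ≤ ((W - d) * y) * (W.descFactorial d * y ^ d) := Nat.mul_le_mul this ih
        _ = _ := by rw [Nat.descFactorial_succ]; ring
  rw [Nat.descFactorial_eq_factorial_mul_choose, Nat.descFactorial_eq_factorial_mul_choose,
    mul_assoc, mul_assoc] at key
  exact Nat.le_of_mul_le_mul_left key Δ.factorial_pos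

theorem exists_expanding_of_sum_lt {ι : Type} [Fintype ι] [DecidableEq ι] {W L Δ : ℕ} {y : ℕ → ℕ}
    (hy : ∀ m, 1 ≤ m → m ≤ L → y m ≤ W) (hsum : ∑ m ∈ Finset.Icc 1 L, (Fintype.card ι).choose m *
      (W.choose (y m) * ((y m).choose Δ ^ m * W.choose Δ ^ (Fintype.card ι - m))) <
      W.choose Δ ^ Fintype.card ι) :
    ∃ f : ι → Finset ℕ, (∀ v, f v ⊆ Finset.Icc 1 W ∧ (f v).card = Δ) ∧
      ∀ X : Finset ι, X.Nonempty → X.card ≤ L → y X.card < (X.biUnion f).card := by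
  classical
  -- The graphs in which all neighbours of `X` lie in `Y`; the hypothesis says that these boxes
  -- cannot cover all graphs.
  let box : Finset ι → Finset ℕ → Finset (ι → Finset ℕ) := fun X Y =>
    Fintype.piFinset fun v => if v ∈ X then Y.powersetCard Δ else (Finset.Icc 1 W).powersetCard Δ
  let bad : Finset (ι → Finset ℕ) := (Finset.Icc 1 L).biUnion fun m =>
    (Finset.univ.powersetCard m).biUnion fun X =>
      ((Finset.Icc 1 W).powersetCard (y m)).biUnion fun Y => box X Y
  let all : Finset (ι → Finset ℕ) := Fintype.piFinset fun _ => (Finset.Icc 1 W).powersetCard Δ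
  have hbox : ∀ X Y, (box X Y).card =
      Y.card.choose Δ ^ X.card * W.choose Δ ^ (Fintype.card ι - X.card) := by
    intro X Y
    rw [Fintype.card_piFinset]
    simp only [apply_ite Finset.card, Finset.card_powersetCard, Nat.card_Icc, Nat.add_sub_cancel]
    rw [Finset.prod_ite, Finset.prod_const, Finset.prod_const, Finset.filter_mem_eq_inter,
      Finset.univ_inter]
    congr 2
    rw [← Finset.card_compl]
    congr 1
    ext v
    simp
  have hbad : bad.card < all.card := by
    have : all.card = W.choose Δ ^ Fintype.card ι := by
      rw [Fintype.card_piFinset]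
      simp [Finset.card_powersetCard]
    rw [this]
    refine lt_of_le_of_lt ?_ hsum
    refine Finset.card_biUnion_le.trans (Finset.sum_le_sum fun m _ => ?_)
    rw [← Finset.card_univ, ← Finset.card_powersetCard m]
    refine Finset.card_biUnion_le_card_mul _ _ _ fun X hX => ?_
    have hW : W.choose (y m) = ((Finset.Icc 1 W).powersetCard (y m)).card := by
      simp [Finset.card_powersetCard]
    rw [hW]
    refine Finset.card_biUnion_le_card_mul _ _ _ fun Y hY => ?_
    rw [hbox, (Finset.mem_powersetCard.1 hX).2, (Finset.mem_powersetCard.1 hY).2, Finset.card_univ]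
  obtain ⟨f, hf, hfb⟩ := Finset.exists_mem_notMem_of_card_lt_card hbad
  have hf' : ∀ v, f v ⊆ Finset.Icc 1 W ∧ (f v).card = Δ := fun v =>
    Finset.mem_powersetCard.1 (Fintype.mem_piFinset.1 hf v)
  refine ⟨f, hf', fun X hX hXL => ?_⟩
  by_contra hcon
  have hm : 1 ≤ X.card := hX.card_pos
  -- A neighbourhood that is too small is padded to exactly `y` outputs, so that it is counted in
  -- some box.
  obtain ⟨Y, hXY, hYW, hYc⟩ := Finset.exists_subsuperset_card_eq
    (Finset.biUnion_subset.2 fun v _ => (hf' v).1 : X.biUnion f ⊆ Finset.Icc 1 W)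
    (not_lt.1 hcon) (by simpa using hy _ hm hXL)
  refine hfb (Finset.mem_biUnion.2 ⟨X.card, Finset.mem_Icc.2 ⟨hm, hXL⟩, Finset.mem_biUnion.2
    ⟨X, Finset.mem_powersetCard.2 ⟨Finset.subset_univ _, rfl⟩, Finset.mem_biUnion.2
    ⟨Y, Finset.mem_powersetCard.2 ⟨hYW, hYc⟩, Fintype.mem_piFinset.2 fun v => ?_⟩⟩⟩)
  split_ifs with hv
  · exact Finset.mem_powersetCard.2
      ⟨(Finset.subset_biUnion_of_mem f hv).trans hXY, (hf' v).2⟩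
  · exact Finset.mem_powersetCard.2 (hf' v)

/-- The estimate C(W,y) ≤ (eW/y)^y without division, from y^y/y! ≤ e^y. -/
theorem choose_mul_pow_le_exp (W y : ℕ) : (W.choose y : ℝ) * y ^ y ≤ Real.exp y * W ^ y := by
  have h1 : (W.choose y : ℝ) ≤ W ^ y / y.factorial := Nat.choose_le_pow_div y W
  have h2 := Real.pow_div_factorial_le_exp (y : ℝ) (Nat.cast_nonneg y) y
  calc (W.choose y : ℝ) * y ^ y ≤ W ^ y / y.factorial * y ^ y := by gcongr
    _ = y ^ y / y.factorial * W ^ y := by ring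
    _ ≤ _ := by gcongr

theorem one_le_logb_div {L V : ℕ} (hL : 1 ≤ L) (hV : (L : ℝ) ≤ V / (200 * Real.exp 4)) :
    200 * (L : ℝ) ≤ V ∧ 1 ≤ Real.logb 2 ((V : ℝ) / L) := by
  have hL0 : (0 : ℝ) < L := by exact_mod_cast hL
  have he := Real.one_le_exp (show (0 : ℝ) ≤ 4 by norm_num)
  rw [le_div_iff₀ (by positivity)] at hV
  have : 200 * (L : ℝ) ≤ V := by nlinarith
  have hV0 : (0 : ℝ) < V := by linarith
  refine ⟨this, ?_⟩
  rw [Real.le_logb_iff_rpow_le (by norm_num) (by positivity), Real.rpow_one, le_div_iff₀ hL0]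
  linarith

theorem pow_eight_logb {x : ℝ} (hx : 0 < x) : (8 : ℝ) ^ Real.logb 2 x = x ^ 3 := by
  rw [show (8 : ℝ) = 2 ^ (3 : ℝ) by norm_num, ← Real.rpow_mul (by norm_num), mul_comm,
    Real.rpow_mul (by norm_num), Real.rpow_logb (by norm_num) (by norm_num) hx]
  norm_cast

/-- With u = m/L and y/W ≤ ue⁻³/8, the first y factors y/W times C(W,y) cost at most e^y. At least
mΔ/4 factors remain; their e⁻³ parts cancel e^y, and 8^lg(V/L) = (V/L)³ leaves at most (u(L/V)³)^m.
Multiplying by C(V,m) ≤ (eV/m)^m gives (e(L/V)²)^m. -/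
theorem expander_term_le {L V m : ℕ} (hL : 1 ≤ L) (hV : (L : ℝ) ≤ V / (200 * Real.exp 4))
    (hm : 1 ≤ m) (hmL : m ≤ L) :
    3 * m * inDegree L V / 4 ≤ outSize L V ∧
    (V.choose m : ℝ) * ((outSize L V).choose (3 * m * inDegree L V / 4) *
      (((3 * m * inDegree L V / 4 : ℕ) : ℝ) / outSize L V) ^ (inDegree L V * m)) ≤
      (1 / 4) ^ m := by
  obtain ⟨hV200, hlam⟩ := one_le_logb_div hL hV
  set lam := Real.logb 2 ((V : ℝ) / L) with hlamdef
  set D := inDegree L V with hD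
  set W := outSize L V with hW
  set y := 3 * m * D / 4 with hy
  have hL0 : (0 : ℝ) < L := by exact_mod_cast hL
  have hm0 : (0 : ℝ) < m := by exact_mod_cast hm
  have hmL' : (m : ℝ) ≤ L := by exact_mod_cast hmL
  have hV0 : (0 : ℝ) < V := by linarith
  have hD1 : 4 * lam ≤ D := Nat.le_ceil _
  have hD2 : (D : ℝ) ≤ 5 * lam := by
    have := (Nat.ceil_lt_add_one (show 0 ≤ 4 * lam by linarith)).le
    change (D : ℝ) ≤ _ at this
    linarith
  have hW1 : 12 * Real.exp 4 * L * lam ≤ W := Nat.le_ceil _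
  have he4 := Real.exp_pos 4
  have hW0 : (0 : ℝ) < W := lt_of_lt_of_le (by positivity) hW1
  have hy1 : (y : ℝ) ≤ 3 * m * D / 4 := by
    have := Nat.cast_div_le (α := ℝ) (m := 3 * m * D) (n := 4)
    push_cast at this
    exact this
  set u : ℝ := m / L with hu
  have hu0 : 0 < u := by positivity
  have hu1 : u ≤ 1 := (div_le_one hL0).2 hmL'
  have he3 : Real.exp 4 = Real.exp 3 * Real.exp 1 := by rw [← Real.exp_add]; norm_num
  have he1 := Real.exp_one_gt_d9
  have hrho : (y : ℝ) / W ≤ u * Real.exp (-3) / 8 := by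
    rw [div_le_iff₀ hW0, Real.exp_neg]
    have h3 := Real.exp_pos 3
    have : u * (Real.exp 3)⁻¹ / 8 * (12 * Real.exp 4 * L * lam) ≤
        u * (Real.exp 3)⁻¹ / 8 * W := by gcongr
    refine le_trans ?_ this
    have hcalc : u * (Real.exp 3)⁻¹ / 8 * (12 * Real.exp 4 * L * lam) =
        3 / 2 * m * lam * Real.exp 1 := by
      rw [he3, hu]
      field_simp
      ring
    rw [hcalc]
    -- What remains is 15/4 < 3e/2, as `y ≤ 3mD/4` and `D ≤ 5 * lam`.
    have hml : 0 < m * lam := by positivity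
    nlinarith [mul_le_mul_of_nonneg_left hD2 hm0.le]
  have hrho1 : u * Real.exp (-3) / 8 ≤ 1 := by
    have : Real.exp (-3) ≤ 1 := Real.exp_le_one_iff.2 (by norm_num)
    have := Real.exp_pos (-3)
    nlinarith
  have hyW : y ≤ W := by
    have := hrho.trans hrho1
    rw [div_le_one hW0] at this
    exact_mod_cast this
  refine ⟨hyW, ?_⟩
  have hyD : y ≤ D * m := by
    have : (y : ℝ) ≤ D * m := by nlinarith [mul_nonneg hm0.le (Nat.cast_nonneg (α := ℝ) D)]
    exact_mod_cast this
  have h1 : (W.choose y : ℝ) * ((y : ℝ) / W) ^ y ≤ Real.exp y := by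
    rw [div_pow, mul_div_assoc', div_le_iff₀ (by positivity)]
    exact choose_mul_pow_le_exp W y
  have hsub : (m * D / 4 : ℝ) ≤ ((D * m - y : ℕ) : ℝ) := by
    rw [Nat.cast_sub hyD]
    push_cast
    linarith
  have h2 : ((y : ℝ) / W) ^ (D * m - y) ≤ (u * Real.exp (-3) / 8) ^ (m * D / 4 : ℝ) := by
    refine (pow_le_pow_left₀ (by positivity) hrho _).trans ?_
    rw [← Real.rpow_natCast]
    exact Real.rpow_le_rpow_of_exponent_ge (by positivity) hrho1 hsub
  have h3 : Real.exp y * (u * Real.exp (-3) / 8) ^ (m * D / 4 : ℝ) ≤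
      (u / 8) ^ (m * D / 4 : ℝ) := by
    rw [show u * Real.exp (-3) / 8 = u / 8 * Real.exp (-3) by ring,
      Real.mul_rpow (by positivity) (by positivity), ← Real.exp_mul, mul_left_comm, ← Real.exp_add]
    refine mul_le_of_le_one_right (by positivity) (Real.exp_le_one_iff.2 ?_)
    linarith
  have h4 : (u / 8) ^ (m * D / 4 : ℝ) ≤ (u * (L / V) ^ 3) ^ m := by
    have hle : (u / 8) ^ (m * D / 4 : ℝ) ≤ (u / 8) ^ (lam * m) := by
      refine Real.rpow_le_rpow_of_exponent_ge (by positivity) (by linarith) ?_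
      nlinarith
    refine hle.trans ?_
    rw [Real.rpow_mul (by positivity), Real.rpow_natCast]
    refine pow_le_pow_left₀ (by positivity) ?_ m
    rw [Real.div_rpow hu0.le (by norm_num), pow_eight_logb (by positivity), div_eq_mul_inv,
      ← inv_pow, inv_div]
    refine mul_le_mul_of_nonneg_right ?_ (by positivity)
    simpa using Real.rpow_le_rpow_of_exponent_ge hu0 hu1 hlam
  have h5 : (V.choose m : ℝ) ≤ (Real.exp 1 * V / m) ^ m := by
    rw [div_pow, le_div_iff₀ (by positivity), mul_pow, ← Real.exp_nat_mul, mul_one]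
    exact choose_mul_pow_le_exp V m
  calc (V.choose m : ℝ) * (W.choose y * ((y : ℝ) / W) ^ (D * m))
      = V.choose m * ((W.choose y * ((y : ℝ) / W) ^ y) * ((y : ℝ) / W) ^ (D * m - y)) := by
        rw [mul_assoc (W.choose y : ℝ), ← pow_add, Nat.add_sub_cancel' hyD]
    _ ≤ (Real.exp 1 * V / m) ^ m * (Real.exp y * (u * Real.exp (-3) / 8) ^ (m * D / 4 : ℝ)) := by
        gcongr
    _ ≤ (Real.exp 1 * V / m) ^ m * (u * (L / V) ^ 3) ^ m := by
        gcongr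
        exact h3.trans h4
    _ = (Real.exp 1 * (L / V) ^ 2) ^ m := by
        rw [← mul_pow]
        congr 1
        rw [hu]
        field_simp
    _ ≤ (1 / 4) ^ m := by
        refine pow_le_pow_left₀ (by positivity) ?_ m
        have h : (L : ℝ) / V ≤ 1 / 200 := by
          rw [div_le_div_iff₀ hV0 (by norm_num)]
          linarith
        have h' : ((L : ℝ) / V) ^ 2 ≤ (1 / 200) ^ 2 := pow_le_pow_left₀ (by positivity) h 2
        nlinarith [Real.exp_one_lt_d9, sq_nonneg ((L : ℝ) / V)]

theorem sum_quarter_pow_lt (L : ℕ) : ∑ m ∈ Finset.Icc 1 L, (1 / 4 : ℝ) ^ m < 1 := by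
  have : ∀ L : ℕ, ∑ m ∈ Finset.Icc 1 L, (1 / 4 : ℝ) ^ m = 1 / 3 - 1 / 3 * (1 / 4) ^ L := by
    intro L
    induction L with
    | zero => simp
    | succ L ih =>
      rw [Finset.sum_Icc_succ_top (by omega), ih]
      ring
  rw [this]
  have : (0 : ℝ) < (1 / 4) ^ L := by positivity
  linarith

theorem exists_losslessExpander {L V : ℕ} (hL : 1 ≤ L) (hV : (L : ℝ) ≤ V / (200 * Real.exp 4)) :
    ∃ Γ, IsLosslessExpander V (outSize L V) L (inDegree L V) (1 / 4) Γ := by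
  classical
  obtain ⟨hV200, hlam⟩ := one_le_logb_div hL hV
  have hL0 : (1 : ℝ) ≤ L := by exact_mod_cast hL
  have hLV : L ≤ V := by
    have : (L : ℝ) ≤ V := by linarith
    exact_mod_cast this
  have hDW : inDegree L V ≤ outSize L V := by
    refine Nat.ceil_le_ceil (mul_le_mul_of_nonneg_right ?_ (by linarith))
    have he := Real.one_le_exp (show (0 : ℝ) ≤ 4 by norm_num)
    nlinarith
  set W := outSize L V with hW
  set D := inDegree L V with hD
  let y : ℕ → ℕ := fun m => 3 * m * D / 4
  have hC : (0 : ℝ) < W.choose D := by exact_mod_cast Nat.choose_pos hDW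
  have hW0 : (0 : ℝ) < W := by
    have : 0 < D := Nat.ceil_pos.2 (by linarith)
    exact_mod_cast this.trans_le hDW
  have hcard : Fintype.card (Finset.Icc 1 V) = V := by simp
  obtain ⟨f, hf, hexp⟩ := exists_expanding_of_sum_lt (ι := Finset.Icc 1 V) (W := W) (L := L)
    (Δ := D) (y := y) (fun m h1 h2 => (expander_term_le hL hV h1 h2).1) (by
      rw [hcard, ← Nat.cast_lt (α := ℝ)]
      push_cast
      calc _ ≤ ∑ m ∈ Finset.Icc 1 L, (1 / 4 : ℝ) ^ m * W.choose D ^ V := by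
            refine Finset.sum_le_sum fun m hm => ?_
            obtain ⟨hm1, hmL⟩ := Finset.mem_Icc.1 hm
            obtain ⟨hyW, hterm⟩ := expander_term_le hL hV hm1 hmL
            have hch : ((y m).choose D : ℝ) ≤ W.choose D * ((y m : ℝ) / W) ^ D := by
              rw [div_pow, mul_div_assoc', le_div_iff₀ (by positivity)]
              exact_mod_cast choose_mul_pow_le D hyW
            calc (V.choose m : ℝ) * (W.choose (y m) *
                  ((y m).choose D ^ m * W.choose D ^ (V - m)))
                ≤ V.choose m * (W.choose (y m) *
                  ((W.choose D * ((y m : ℝ) / W) ^ D) ^ m * W.choose D ^ (V - m))) := by gcongr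
              _ = (V.choose m * (W.choose (y m) * ((y m : ℝ) / W) ^ (D * m))) *
                    (W.choose D ^ m * W.choose D ^ (V - m)) := by
                  rw [mul_pow, ← pow_mul]
                  ring
              _ ≤ (1 / 4) ^ m * W.choose D ^ V := by
                  rw [← pow_add, Nat.add_sub_cancel' (hmL.trans hLV)]
                  gcongr
        _ < W.choose D ^ V := by
            rw [← Finset.sum_mul]
            exact mul_lt_of_lt_one_left (by positivity) (sum_quarter_pow_lt L))
  -- Adjacency outside `[V]` is never examined and is set to be empty.
  let g : ℕ → Finset ℕ := fun v => if h : v ∈ Finset.Icc 1 V then f ⟨v, h⟩ else ∅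
  have hg : ∀ v (h : v ∈ Finset.Icc 1 V), g v = f ⟨v, h⟩ := fun v h => dif_pos h
  refine ⟨fun v => (g v).toList, ⟨fun v _ => Finset.nodup_toList _, fun v hv w hw => ?_,
    fun v hv => ?_, fun X hX hne hXL => ?_⟩⟩
  · rw [Finset.mem_toList, hg v hv] at hw
    exact (hf _).1 hw
  · rw [Finset.length_toList, hg v hv, (hf _).2]
  · simp only [Finset.toList_toFinset]
    let X' : Finset (Finset.Icc 1 V) := X.subtype (· ∈ Finset.Icc 1 V)
    have hX'c : X'.card = X.card := by
      rw [Finset.card_subtype, Finset.filter_true_of_mem fun x hx => hX hx]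
    have hX'ne : X'.Nonempty := by
      rw [← Finset.card_pos, hX'c]
      exact hne.card_pos
    have h1 := hexp X' hX'ne (hX'c.trans_le hXL)
    have h2 : X'.biUnion f ⊆ X.biUnion g := by
      refine Finset.biUnion_subset.2 fun v hv => ?_
      rw [← hg v.1 v.2]
      exact Finset.subset_biUnion_of_mem g (Finset.mem_subtype.1 hv)
    have h3 := h1.trans_le (Finset.card_le_card h2)
    rw [hX'c] at h3
    -- For integers, exceeding ⌊3mD/4⌋ is the same as exceeding 3mD/4.
    have h4 : 3 * X.card * D < 4 * (X.biUnion g).card := by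
      simp only [y] at h3
      omega
    have h5 : (3 * X.card * D : ℝ) < 4 * (X.biUnion g).card := by exact_mod_cast h4
    linarith

theorem nonempty_expanderFamily : Nonempty ExpanderFamily := by
  classical
  have key : ∀ L V : ℕ, ∃ Γ, 1 ≤ L → (L : ℝ) ≤ V / (200 * Real.exp 4) →
      IsLosslessExpander V (outSize L V) L (inDegree L V) (1 / 4) Γ := by
    intro L V
    by_cases h : 1 ≤ L ∧ (L : ℝ) ≤ V / (200 * Real.exp 4)
    · obtain ⟨Γ, hΓ⟩ := exists_losslessExpander h.1 h.2
      exact ⟨Γ, fun _ _ => hΓ⟩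
    · exact ⟨fun _ => [], fun h1 h2 => absurd ⟨h1, h2⟩ h⟩
  choose Γ hΓ using key
  exact ⟨⟨Γ, hΓ⟩⟩

/-! ### The ranges of names and the number of epochs -/

theorem sum_geometric (a : ℝ) (m : ℕ) :
    ∑ s ∈ Finset.range m, (a + s) / 2 ^ s = 2 * (a + 1) - (a + m + 1) * 2 / 2 ^ m := by
  induction m with
  | zero => simp; ring
  | succ m ih =>
    rw [Finset.sum_range_succ, ih, pow_succ]
    field_simp
    push_cast
    ring

theorem sum_geometric_le {a : ℝ} (ha : 0 ≤ a) (m : ℕ) :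
    ∑ s ∈ Finset.range m, (a + s) / 2 ^ s ≤ 2 * (a + 1) := by
  rw [sum_geometric]
  have : 0 ≤ (a + m + 1) * 2 / 2 ^ m := by positivity
  linarith

theorem sum_two_pow_le (m : ℕ) : ∑ i ∈ Finset.range (m + 1), (2 : ℝ) ^ i ≤ 2 * 2 ^ m := by
  rw [geom_sum_eq (by norm_num), pow_succ]
  linarith

theorem one_le_exp_four : 1 ≤ Real.exp 4 := Real.one_le_exp (by norm_num)

theorem exp_four_lt : Real.exp 4 < 55 := by
  have h : Real.exp 4 = Real.exp 1 ^ 4 := by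
    rw [← Real.exp_nat_mul]
    norm_num
  rw [h]
  calc Real.exp 1 ^ 4 < 2.7182818286 ^ 4 :=
        pow_lt_pow_left₀ Real.exp_one_lt_d9 (Real.exp_pos 1).le (by norm_num)
    _ < 55 := by norm_num

theorem logb_two_le {x : ℝ} (hx : 0 < x) : Real.logb 2 x ≤ 2 * x := by
  rw [Real.logb, div_le_iff₀ (Real.log_pos (by norm_num))]
  have h1 := Real.log_le_sub_one_of_pos hx
  have h2 := Real.log_two_gt_d9
  nlinarith

theorem cast_stage (i s : ℕ) (hs : s ≤ i) : ((2 ^ i / 2 ^ s : ℕ) : ℝ) = 2 ^ i / 2 ^ s := by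
  rw [Nat.cast_div (pow_dvd_pow 2 hs) (by positivity)]
  push_cast
  rfl

theorem logb_stage {i s N : ℕ} (hs : s ≤ i) (hN : 0 < N) :
    Real.logb 2 ((N : ℝ) / (2 ^ i / 2 ^ s : ℕ)) = Real.logb 2 ((N : ℝ) / 2 ^ i) + s := by
  have hN0 : (0 : ℝ) < N := by exact_mod_cast hN
  rw [cast_stage i s hs, div_div_eq_mul_div, mul_div_right_comm,
    Real.logb_mul (by positivity) (by positivity), Real.logb_pow,
    Real.logb_self_eq_one (by norm_num), mul_one]

theorem outSize_stage_le {i s N : ℕ} (hs : s ≤ i) (hN : 2 ^ i ≤ N) :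
    (outSize (2 ^ i / 2 ^ s) N : ℝ) ≤
      12 * Real.exp 4 * 2 ^ i * ((Real.logb 2 ((N : ℝ) / 2 ^ i) + s) / 2 ^ s) + 1 := by
  have h0 : 0 ≤ Real.logb 2 ((N : ℝ) / 2 ^ i) := by
    refine Real.logb_nonneg (by norm_num) ?_
    rw [one_le_div (by positivity)]
    exact_mod_cast hN
  have he := Real.exp_pos 4
  rw [outSize, logb_stage hs ((pow_pos two_pos i).trans_le hN), cast_stage i s hs]
  refine (Nat.ceil_lt_add_one (by positivity)).le.trans (le_of_eq ?_)
  ring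

/-- Halving `L` adds 1 to lg(N/L), so the stages form the series ∑ (l+s)/2^s ≤ 2(l+1); the `i + 1 ≤
2 ^ i` roundings are absorbed by passing from `l + 1` to `l + 2`. -/
theorem basicRange_le {i N : ℕ} (hN : 2 ^ i ≤ N) :
    (basicRange i N : ℝ) ≤ 2 ^ i * (24 * Real.exp 4 * (Real.logb 2 ((N : ℝ) / 2 ^ i) + 2)) := by
  have h0 : 0 ≤ Real.logb 2 ((N : ℝ) / 2 ^ i) := by
    refine Real.logb_nonneg (by norm_num) ?_
    rw [one_le_div (by positivity)]
    exact_mod_cast hN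
  have he := one_le_exp_four
  set l := Real.logb 2 ((N : ℝ) / 2 ^ i)
  have hi : ((i + 1 : ℕ) : ℝ) ≤ 2 ^ i := by
    exact_mod_cast Nat.lt_two_pow_self (n := i)
  have hp : (0 : ℝ) < 2 ^ i := by positivity
  rw [basicRange, stageOffset]
  push_cast
  calc ∑ s ∈ Finset.range (i + 1), (outSize (2 ^ i / 2 ^ s) N : ℝ)
      ≤ ∑ s ∈ Finset.range (i + 1), (12 * Real.exp 4 * 2 ^ i * ((l + s) / 2 ^ s) + 1) :=
        Finset.sum_le_sum fun s hs =>
          outSize_stage_le (Nat.lt_succ_iff.1 (Finset.mem_range.1 hs)) hN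
    _ = 12 * Real.exp 4 * 2 ^ i * ∑ s ∈ Finset.range (i + 1), (l + s) / 2 ^ s + (i + 1 : ℕ) := by
        rw [Finset.sum_add_distrib, ← Finset.mul_sum]
        simp
    _ ≤ 12 * Real.exp 4 * 2 ^ i * (2 * (l + 1)) + 2 ^ i := by
        gcongr
        exact sum_geometric_le h0 _
    _ ≤ _ := by nlinarith

/-- By lg x ≤ 16 + x/2¹⁵ the left side is at most 432e⁴ + 24e⁴x/2¹⁵; the first term is below 9x/16
by the threshold, the second is small as e⁴ < 55. -/
theorem contraction {x : ℝ} (hx : 768 * Real.exp 4 < x) :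
    24 * Real.exp 4 * (Real.logb 2 x + 2) ≤ 3 / 4 * x := by
  have he := Real.exp_pos 4
  have hx0 : 0 < x := by linarith
  have h1 : Real.logb 2 x ≤ 16 + x / 32768 := by
    have h2 := logb_two_le (show 0 < x / 2 ^ 16 by positivity)
    rw [Real.logb_div hx0.ne' (by positivity), Real.logb_pow,
      Real.logb_self_eq_one (by norm_num)] at h2
    norm_num at h2
    linarith
  have h3 : Real.exp 4 * x ≤ 55 * x := mul_le_mul_of_nonneg_right exp_four_lt.le hx0.le
  nlinarith [mul_le_mul_of_nonneg_left h1 he.le]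

section Epochs

variable {i N : ℕ}

theorem rangeAfter_succ_le {t : ℕ} (h : 768 * Real.exp 4 * 2 ^ i < rangeAfter i N t) :
    (rangeAfter i N (t + 1) : ℝ) / 2 ^ i ≤
      24 * Real.exp 4 * (Real.logb 2 ((rangeAfter i N t : ℝ) / 2 ^ i) + 2) ∧
    24 * Real.exp 4 * (Real.logb 2 ((rangeAfter i N t : ℝ) / 2 ^ i) + 2) ≤
      3 / 4 * ((rangeAfter i N t : ℝ) / 2 ^ i) := by
  have hp : (0 : ℝ) < 2 ^ i := by positivity
  have he := one_le_exp_four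
  refine ⟨?_, contraction (by rwa [lt_div_iff₀ hp])⟩
  rw [div_le_iff₀ hp, mul_comm]
  refine basicRange_le ?_
  have : (2 : ℝ) ^ i ≤ rangeAfter i N t := by nlinarith
  exact_mod_cast this

/-- The infimum is attained only if the threshold is ever reached. Otherwise the natural numbers
`rangeAfter i N t` would decrease strictly forever. -/
theorem rangeAfter_numEpochs_le (i N : ℕ) :
    (rangeAfter i N (numEpochs i N) : ℝ) ≤ 768 * Real.exp 4 * 2 ^ i := by
  refine Nat.sInf_mem (s := {t : ℕ | (rangeAfter i N t : ℝ) ≤ 768 * Real.exp 4 * 2 ^ i}) ?_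
  by_contra hne
  rw [not_nonempty_iff_eq_empty] at hne
  have hlt : ∀ t, 768 * Real.exp 4 * 2 ^ i < rangeAfter i N t := by
    intro t
    by_contra ht
    have : t ∈ (∅ : Set ℕ) := hne ▸ not_lt.1 ht
    exact this
  have hanti : StrictAnti (rangeAfter i N) := by
    refine strictAnti_nat_of_succ_lt fun t => ?_
    have hp : (0 : ℝ) < 2 ^ i := by positivity
    obtain ⟨h1, h2⟩ := rangeAfter_succ_le (hlt t)
    have h3 := h1.trans h2
    rw [← mul_div_assoc, div_le_div_iff_of_pos_right hp] at h3
    have h4 : (0 : ℝ) < rangeAfter i N t := lt_trans (by positivity) (hlt t)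
    have : (rangeAfter i N (t + 1) : ℝ) < rangeAfter i N t := by linarith
    exact_mod_cast this
  have hbound : ∀ t, rangeAfter i N t + t ≤ N := by
    intro t
    induction t with
    | zero => exact le_rfl
    | succ t ih =>
      have := hanti (show t < t + 1 by omega)
      omega
  have := hbound (N + 1)
  omega

variable {l : ℝ}

/-- The logarithmic bound is used for the first epoch, the contraction for the others. The bound `l`
is demanded only if an epoch is run, which makes `N` positive. -/
theorem rangeAfter_succ_le_geometric
    (h : 0 < numEpochs i N → Real.logb 2 ((N : ℝ) / 2 ^ i) ≤ l) {t : ℕ} (ht : t < numEpochs i N) :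
    (rangeAfter i N (t + 1) : ℝ) / 2 ^ i ≤ (3 / 4) ^ t * (24 * Real.exp 4 * (l + 2)) := by
  induction t with
  | zero =>
    refine (rangeAfter_succ_le (lt_rangeAfter ht)).1.trans ?_
    have he := Real.exp_pos 4
    have := h ht
    rw [pow_zero, one_mul]
    simp only [rangeAfter]
    gcongr
  | succ t ih =>
    obtain ⟨h1, h2⟩ := rangeAfter_succ_le (lt_rangeAfter ht)
    have h3 := ih (by omega)
    rw [pow_succ]
    linarith

theorem sum_rangeAfter_le (hl : 0 ≤ l)
    (h : 0 < numEpochs i N → Real.logb 2 ((N : ℝ) / 2 ^ i) ≤ l) :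
    ∑ t ∈ Finset.range (numEpochs i N), (rangeAfter i N (t + 1) : ℝ) / 2 ^ i ≤
      96 * Real.exp 4 * (l + 2) := by
  have he := Real.exp_pos 4
  refine (Finset.sum_le_sum fun t ht =>
    rangeAfter_succ_le_geometric h (Finset.mem_range.1 ht)).trans ?_
  rw [← Finset.sum_mul]
  have hgeom : ∑ t ∈ Finset.range (numEpochs i N), (3 / 4 : ℝ) ^ t ≤ 4 := by
    rw [geom_sum_eq (by norm_num)]
    have : (0 : ℝ) < (3 / 4) ^ numEpochs i N := by positivity
    rw [div_le_iff_of_neg (by norm_num)]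
    linarith
  have : 0 ≤ 24 * Real.exp 4 * (l + 2) := by positivity
  nlinarith

/-- If epoch `t + 1` is run, then 768e⁴ < (3/4)^t · 24e⁴(l+2), so 32(4/3)^t < l+2; finally ln(4/3) ≥
1/4. -/
theorem numEpochs_le (hl : 0 ≤ l)
    (h : 0 < numEpochs i N → Real.logb 2 ((N : ℝ) / 2 ^ i) ≤ l) :
    (numEpochs i N : ℝ) ≤ 2 + 4 * Real.log (l + 2) := by
  have hlog : 0 ≤ Real.log (l + 2) := Real.log_nonneg (by linarith)
  rcases le_or_gt (numEpochs i N) 1 with h1 | h1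
  · have : (numEpochs i N : ℝ) ≤ 1 := by exact_mod_cast h1
    linarith
  obtain ⟨t, ht⟩ := Nat.exists_eq_add_of_lt h1
  have hp : (0 : ℝ) < 2 ^ i := by positivity
  have he := Real.exp_pos 4
  have h2 := rangeAfter_succ_le_geometric h (t := t) (by omega)
  have h3 := lt_rangeAfter (i := i) (N := N) (t := t + 1) (by omega)
  rw [← lt_div_iff₀ hp] at h3
  have h4 : 32 * (4 / 3) ^ t ≤ l + 2 := by
    have h5 : (4 / 3 : ℝ) ^ t * (3 / 4) ^ t = 1 := by
      rw [← mul_pow]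
      norm_num
    have h6 : (0 : ℝ) < (4 / 3) ^ t := by positivity
    have h7 := mul_le_mul_of_nonneg_left (h3.le.trans h2) h6.le
    rw [← mul_assoc ((4 / 3 : ℝ) ^ t) ((3 / 4) ^ t), h5, one_mul] at h7
    nlinarith
  have h5 : (t : ℝ) * Real.log (4 / 3) ≤ Real.log (l + 2) := by
    rw [← Real.log_pow]
    refine Real.log_le_log (by positivity) ?_
    have : (0 : ℝ) < (4 / 3) ^ t := by positivity
    linarith
  have h6 : (1 : ℝ) / 4 ≤ Real.log (4 / 3) := by
    have := Real.one_sub_inv_le_log_of_pos (show (0 : ℝ) < 4 / 3 by norm_num)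
    norm_num at this ⊢
    exact this
  have h7 : (t : ℝ) * (1 / 4) ≤ t * Real.log (4 / 3) := by gcongr
  rw [ht]
  push_cast
  linarith

/-- Only the first epoch pays `l`; the others are bounded by lg x ≤ 2x and the geometric decay. This
keeps a log log factor off the term log n in the step bound. -/
theorem sum_logb_rangeAfter_le (hl : 0 ≤ l)
    (h : 0 < numEpochs i N → Real.logb 2 ((N : ℝ) / 2 ^ i) ≤ l) :
    ∑ t ∈ Finset.range (numEpochs i N), Real.logb 2 ((rangeAfter i N t : ℝ) / 2 ^ i) ≤
      193 * Real.exp 4 * (l + 2) := by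
  have he := one_le_exp_four
  have hsum := sum_rangeAfter_le hl h
  rcases hT : numEpochs i N with _ | T
  · simp only [Finset.range_zero, Finset.sum_empty]
    positivity
  rw [hT] at hsum
  rw [Finset.sum_range_succ']
  have h0 : Real.logb 2 ((rangeAfter i N 0 : ℝ) / 2 ^ i) ≤ l := h (by omega)
  have h1 : ∑ t ∈ Finset.range T, Real.logb 2 ((rangeAfter i N (t + 1) : ℝ) / 2 ^ i) ≤
      2 * ∑ t ∈ Finset.range (T + 1), (rangeAfter i N (t + 1) : ℝ) / 2 ^ i := by
    rw [Finset.mul_sum, Finset.sum_range_succ]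
    refine (Finset.sum_le_sum fun t ht => logb_two_le ?_).trans
      (le_add_of_nonneg_right (by positivity))
    have := Finset.mem_range.1 ht
    have := lt_rangeAfter (i := i) (N := N) (t := t + 1) (by omega)
    have : (0 : ℝ) < rangeAfter i N (t + 1) := lt_trans (by positivity) this
    positivity
  nlinarith

theorem basicCost_le {N : ℕ} (hN : 768 * Real.exp 4 * 2 ^ i < N) :
    (basicCost i N : ℝ) ≤ 5 * (i + 1) * (4 * (Real.logb 2 ((N : ℝ) / 2 ^ i) + i) + 1) := by
  have he := one_le_exp_four
  have hp : (0 : ℝ) < 2 ^ i := by positivity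
  have hN' : (2 : ℝ) ^ i ≤ N := by nlinarith
  have h0 : 0 ≤ Real.logb 2 ((N : ℝ) / 2 ^ i) :=
    Real.logb_nonneg (by norm_num) ((one_le_div hp).2 hN')
  have hN0 : 0 < N := by
    have : (0 : ℝ) < N := hp.trans_le hN'
    exact_mod_cast this
  rw [basicCost]
  push_cast
  calc ∑ s ∈ Finset.range (i + 1), 5 * (inDegree (2 ^ i / 2 ^ s) N : ℝ)
      ≤ ∑ s ∈ Finset.range (i + 1), 5 * (4 * (Real.logb 2 ((N : ℝ) / 2 ^ i) + i) + 1) := by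
        refine Finset.sum_le_sum fun s hs => ?_
        have hs' : s ≤ i := Nat.lt_succ_iff.1 (Finset.mem_range.1 hs)
        have hsr : (s : ℝ) ≤ i := by exact_mod_cast hs'
        rw [inDegree, logb_stage hs' hN0]
        have := (Nat.ceil_lt_add_one
          (show 0 ≤ 4 * (Real.logb 2 ((N : ℝ) / 2 ^ i) + s) by positivity)).le
        linarith
    _ = _ := by
        rw [Finset.sum_const, Finset.card_range, nsmul_eq_mul]
        push_cast
        ring

theorem polyLogCost_le (hl : 0 ≤ l)
    (h : 0 < numEpochs i N → Real.logb 2 ((N : ℝ) / 2 ^ i) ≤ l) :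
    (polyLogCost i N : ℝ) ≤ 5 * (i + 1) *
      (772 * Real.exp 4 * (l + 2) + (2 + 4 * Real.log (l + 2)) * (4 * (i + 1))) := by
  rw [polyLogCost]
  push_cast
  have h1 := sum_logb_rangeAfter_le hl h
  have h2 := numEpochs_le hl h
  calc ∑ t ∈ Finset.range (numEpochs i N), (basicCost i (rangeAfter i N t) : ℝ)
      ≤ ∑ t ∈ Finset.range (numEpochs i N), 5 * (i + 1 : ℝ) *
          (4 * (Real.logb 2 ((rangeAfter i N t : ℝ) / 2 ^ i) + i) + 1) :=
        Finset.sum_le_sum fun t ht => basicCost_le (lt_rangeAfter (Finset.mem_range.1 ht))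
    _ = 5 * (i + 1) * (4 * ∑ t ∈ Finset.range (numEpochs i N),
          Real.logb 2 ((rangeAfter i N t : ℝ) / 2 ^ i) + numEpochs i N * (4 * i + 1)) := by
        rw [← Finset.mul_sum]
        congr 1
        have hconst : (numEpochs i N * (4 * i + 1) : ℝ) =
            ∑ _t ∈ Finset.range (numEpochs i N), (4 * i + 1 : ℝ) := by
          rw [Finset.sum_const, Finset.card_range, nsmul_eq_mul]
        rw [Finset.mul_sum, hconst, ← Finset.sum_add_distrib]
        exact Finset.sum_congr rfl fun t _ => by ring
    _ ≤ 5 * (i + 1) * (4 * (193 * Real.exp 4 * (l + 2)) +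
          (2 + 4 * Real.log (l + 2)) * (4 * (i + 1))) := by
        have h3 : (4 * i + 1 : ℝ) ≤ 4 * (i + 1) := by linarith
        have h4 : 0 ≤ Real.log (l + 2) := Real.log_nonneg (by linarith)
        gcongr
    _ = _ := by ring

end Epochs

/-! ### The range of new names -/

theorem two_pow_clog_le {k : ℕ} (hk : 1 ≤ k) : 2 ^ Nat.clog 2 k ≤ 2 * k := by
  rcases hk.eq_or_lt with rfl | hk
  · simp
  · have h1 := Nat.pow_pred_clog_lt_self (b := 2) (by norm_num) hk
    have h2 := Nat.clog_pos (b := 2) (by norm_num) hk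
    obtain ⟨c, hc⟩ := Nat.exists_eq_add_of_lt h2
    rw [hc] at h1 ⊢
    simp only [zero_add, Nat.pred_succ] at h1 ⊢
    rw [pow_succ]
    omega

theorem phaseOffset_le {k : ℕ} (hk : 1 ≤ k) (N : ℕ) :
    (phaseOffset N (Nat.clog 2 k + 1) : ℝ) ≤ 3072 * Real.exp 4 * k := by
  have he := Real.exp_pos 4
  have h1 : ((2 : ℝ) ^ Nat.clog 2 k) ≤ 2 * k := by exact_mod_cast two_pow_clog_le hk
  rw [phaseOffset]
  push_cast
  calc ∑ l ∈ Finset.range (Nat.clog 2 k + 1), (rangeAfter l N (numEpochs l N) : ℝ)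
      ≤ ∑ l ∈ Finset.range (Nat.clog 2 k + 1), 768 * Real.exp 4 * 2 ^ l :=
        Finset.sum_le_sum fun l _ => rangeAfter_numEpochs_le l N
    _ ≤ 768 * Real.exp 4 * (2 * 2 ^ Nat.clog 2 k) := by
        rw [← Finset.mul_sum]
        gcongr
        exact sum_two_pow_le _
    _ ≤ 768 * Real.exp 4 * (2 * (2 * k)) := by gcongr
    _ = _ := by ring

/-! ### The number of registers -/

/-- The nodes of epoch `t` are as many as the names in its range, and each owns two registers. -/
theorem ncard_phaseRegisters_le (N m : ℕ) : (phaseRegisters N 0 m).Finite ∧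
    (phaseRegisters N 0 m).ncard ≤ ∑ i ∈ Finset.range m, ∑ t ∈ Finset.range (numEpochs i N),
      2 * rangeAfter i N (t + 1) := by
  classical
  let F : Finset Register := (Finset.range m).biUnion fun i =>
    (Finset.range (numEpochs i N)).biUnion fun t => (Finset.range (i + 1)).biUnion fun s =>
      (Finset.Icc 1 (outSize (2 ^ i / 2 ^ s) (rangeAfter i N t))).biUnion fun w =>
        {⟨i, t, s, w, false⟩, ⟨i, t, s, w, true⟩}
  have hsub : phaseRegisters N 0 m ⊆ F := by
    rintro ⟨i, t, s, w, b⟩ ⟨-, h1, h2, h3, h4⟩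
    simp only [F, Finset.coe_biUnion, mem_iUnion, Finset.mem_coe, Finset.mem_range,
      Finset.mem_Icc, exists_prop]
    exact ⟨i, h1, t, h2, s, Nat.lt_succ_iff.2 h3, w, h4, by cases b <;> simp⟩
  refine ⟨F.finite_toSet.subset hsub, ?_⟩
  refine (ncard_le_ncard hsub F.finite_toSet).trans ?_
  rw [ncard_coe_finset]
  refine Finset.card_biUnion_le.trans (Finset.sum_le_sum fun i _ => ?_)
  refine Finset.card_biUnion_le.trans (Finset.sum_le_sum fun t _ => ?_)
  refine Finset.card_biUnion_le.trans ?_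
  rw [rangeAfter, basicRange, stageOffset, Finset.mul_sum]
  refine Finset.sum_le_sum fun s _ => ?_
  refine (Finset.card_biUnion_le_card_mul _ _ 2 fun w _ => Finset.card_le_two).trans ?_
  rw [Nat.card_Icc, Nat.add_sub_cancel, mul_comm]

/-- The bound `l` may vary with the phase, which the linear register count needs. -/
theorem usesAtMost_of_logb_le (G : ExpanderFamily) (n N : ℕ) {l : ℕ → ℝ} (hl : ∀ i, 0 ≤ l i)
    (h : ∀ i ≤ Nat.clog 2 n, 0 < numEpochs i N → Real.logb 2 ((N : ℝ) / 2 ^ i) ≤ l i) {b : ℝ}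
    (hb : ∑ i ∈ Finset.range (Nat.clog 2 n + 1), 2 ^ i * (192 * Real.exp 4 * (l i + 2)) ≤ b) :
    UsesAtMost N (almostAdaptive G n N) b := by
  have hsub : usedRegisters N (almostAdaptive G n N) ⊆
      phaseRegisters N 0 (Nat.clog 2 n + 1) := by
    refine iUnion₂_subset fun p hp => ?_
    rw [almostAdaptive, List.range_eq_range']
    simpa using phases_registers hp (Nat.clog 2 n + 1) 0
  obtain ⟨hfin, hcard⟩ := ncard_phaseRegisters_le N (Nat.clog 2 n + 1)
  refine ⟨hfin.subset hsub, le_trans ?_ hb⟩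
  have h1 : ((usedRegisters N (almostAdaptive G n N)).ncard : ℝ) ≤
      ((∑ i ∈ Finset.range (Nat.clog 2 n + 1), ∑ t ∈ Finset.range (numEpochs i N),
        2 * rangeAfter i N (t + 1) : ℕ) : ℝ) :=
    Nat.cast_le.2 ((ncard_le_ncard hsub hfin).trans hcard)
  refine h1.trans ?_
  push_cast
  refine Finset.sum_le_sum fun i hi => ?_
  have h2 := sum_rangeAfter_le (hl i) (h i (Nat.lt_succ_iff.1 (Finset.mem_range.1 hi)))
  have hp : (0 : ℝ) < 2 ^ i := by positivity
  rw [← Finset.sum_div, div_le_iff₀ hp] at h2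
  rw [← Finset.mul_sum]
  linarith

/-! ### The bounds -/

theorem one_le_lg (x : ℝ) : 1 ≤ lg x := le_max_left _ _

theorem logb_le_lg (x : ℝ) : Real.logb 2 x ≤ lg x := le_max_right _ _

theorem one_le_stepBound (n k : ℕ) : 1 ≤ stepBound n k := by
  have h1 := one_le_lg n
  have h2 := one_le_lg k
  have h3 := one_le_lg (lg n)
  rw [stepBound]
  have h4 : 1 ≤ lg k ^ 2 := one_le_pow₀ h2
  have h5 : 1 ≤ lg n + lg k * lg (lg n) := by nlinarith
  nlinarith

theorem clog_add_one_le {k : ℕ} (hk : 1 ≤ k) : (Nat.clog 2 k + 1 : ℝ) ≤ 3 * lg k := by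
  have hk0 : (0 : ℝ) < k := by exact_mod_cast hk
  have h1 : ((2 : ℝ) ^ Nat.clog 2 k) ≤ 2 * k := by exact_mod_cast two_pow_clog_le hk
  have h2 := Real.logb_le_logb_of_le (b := 2) (by norm_num) (by positivity) h1
  rw [Real.logb_pow, Real.logb_self_eq_one (by norm_num),
    Real.logb_mul (by norm_num) hk0.ne', Real.logb_self_eq_one (by norm_num)] at h2
  have h3 := logb_le_lg k
  have h4 := one_le_lg k
  linarith

theorem pos_of_numEpochs_pos {i N : ℕ} (h : 0 < numEpochs i N) : (0 : ℝ) < N :=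
  lt_trans (by positivity) (lt_rangeAfter (t := 0) h)

theorem logb_div_le {c : ℝ} (hc : 1 ≤ c) {d n N : ℕ} (hn : 1 ≤ n) (hN : (N : ℝ) ≤ c * (n : ℝ) ^ d)
    (i : ℕ) (hN0 : (0 : ℝ) < N) :
    Real.logb 2 ((N : ℝ) / 2 ^ i) ≤ (Real.logb 2 c + d) * lg n := by
  have hn0 : (0 : ℝ) < n := by exact_mod_cast hn
  have h1 : (N : ℝ) / 2 ^ i ≤ c * (n : ℝ) ^ d :=
    (div_le_self hN0.le (one_le_pow₀ (by norm_num))).trans hN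
  refine (Real.logb_le_logb_of_le (by norm_num) (by positivity) h1).trans ?_
  rw [Real.logb_mul (by positivity) (by positivity), Real.logb_pow, add_mul]
  have h2 : 0 ≤ Real.logb 2 c := Real.logb_nonneg (by norm_num) hc
  exact add_le_add (le_mul_of_one_le_right h2 (one_le_lg _))
    (mul_le_mul_of_nonneg_left (logb_le_lg _) (Nat.cast_nonneg d))

theorem log_mul_lg_le {D : ℝ} (hD : 1 ≤ D) (x : ℝ) :
    Real.log (D * lg x) ≤ (Real.log D + 1) * lg (lg x) := by
  have h1 := one_le_lg x
  have h2 := one_le_lg (lg x)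
  have h3 : Real.log (lg x) ≤ lg (lg x) := by
    refine le_trans ?_ (logb_le_lg _)
    rw [Real.logb, le_div_iff₀ (Real.log_pos (by norm_num))]
    exact mul_le_of_le_one_right (Real.log_nonneg h1) (by linarith [Real.log_two_lt_d9])
  rw [Real.log_mul (by positivity) (by positivity), add_mul, one_mul]
  exact add_le_add (le_mul_of_one_le_right (Real.log_nonneg hD) h2) h3

/-- At most 3 lg k phases matter, with at most 3 lg k stages per epoch in each. A stage costs its
share of the log n total, plus O(lg k) in each of O(log log n) epochs. -/
theorem exists_sum_polyLogCost_le {c : ℝ} (hc : 1 ≤ c) (d : ℕ) : ∃ B : ℝ, 0 ≤ B ∧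
    ∀ n N k : ℕ, 1 ≤ n → 1 ≤ k → (N : ℝ) ≤ c * (n : ℝ) ^ d →
      ((∑ i ∈ Finset.range (Nat.clog 2 k + 1), polyLogCost i N : ℕ) : ℝ) ≤ B * stepBound n k := by
  have hc0 : 0 ≤ Real.logb 2 c := Real.logb_nonneg (by norm_num) hc
  set D : ℝ := Real.logb 2 c + d + 2 with hD
  have hD1 : 1 ≤ D := by
    have : (0 : ℝ) ≤ d := Nat.cast_nonneg d
    linarith
  have hlogD := Real.log_nonneg hD1
  have he := Real.exp_pos 4
  refine ⟨45 * (772 * Real.exp 4 * D + 12 * (6 + 4 * Real.log D)), by positivity,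
    fun n N k hn hk hN => ?_⟩
  have h1 := one_le_lg n
  have h2 := one_le_lg k
  have h3 := one_le_lg (lg n)
  set a := lg n
  set b := lg (lg n)
  set j := Nat.clog 2 k
  set l : ℝ := (Real.logb 2 c + d) * a with hldef
  have hl : 0 ≤ l := by positivity
  have hlD : l + 2 ≤ D * a := by
    rw [hldef, hD]
    nlinarith
  have hloglD : 2 + 4 * Real.log (l + 2) ≤ (6 + 4 * Real.log D) * b := by
    have h4 := (Real.log_le_log (by linarith) hlD).trans (log_mul_lg_le hD1 n)
    change _ ≤ _ * b at h4
    nlinarith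
  have hj := clog_add_one_le hk
  push_cast
  calc ∑ i ∈ Finset.range (j + 1), (polyLogCost i N : ℝ)
      ≤ ∑ i ∈ Finset.range (j + 1), 5 * (3 * lg k) *
          (772 * Real.exp 4 * (D * a) + (6 + 4 * Real.log D) * b * (4 * (3 * lg k))) := by
        refine Finset.sum_le_sum fun i hi => (polyLogCost_le hl fun h =>
          logb_div_le hc hn hN i (pos_of_numEpochs_pos h)).trans ?_
        have hi' : (i + 1 : ℝ) ≤ 3 * lg k := by
          have : (i : ℝ) ≤ j := by exact_mod_cast Nat.lt_succ_iff.1 (Finset.mem_range.1 hi)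
          linarith
        have h4 : 0 ≤ Real.log (l + 2) := Real.log_nonneg (by linarith)
        gcongr
    _ = (j + 1) * (5 * (3 * lg k) *
          (772 * Real.exp 4 * (D * a) + (6 + 4 * Real.log D) * b * (4 * (3 * lg k)))) := by
        rw [Finset.sum_const, Finset.card_range, nsmul_eq_mul]
        push_cast
        ring
    _ ≤ (3 * lg k) * (5 * (3 * lg k) *
          (772 * Real.exp 4 * (D * a) + (6 + 4 * Real.log D) * b * (4 * (3 * lg k)))) := by
        gcongr
    _ = 45 * lg k ^ 2 *
          ((772 * Real.exp 4 * D) * a + (12 * (6 + 4 * Real.log D)) * (lg k * b)) := by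
        ring
    _ ≤ 45 * lg k ^ 2 *
          ((772 * Real.exp 4 * D + 12 * (6 + 4 * Real.log D)) * (a + lg k * b)) := by
        have h5 : 0 ≤ 772 * Real.exp 4 * D := by positivity
        have h6 : 0 ≤ 12 * (6 + 4 * Real.log D) := by positivity
        have h7 : 0 ≤ lg k * b := by positivity
        gcongr
        nlinarith
    _ = _ := by
        rw [stepBound]
        ring

/-! ### The renaming property and the two register counts. -/

theorem exists_isRenaming (c : ℝ) (d : ℕ) : ∃ B : ℝ, ∀ B' ≥ B, ∀ (G : ExpanderFamily) (n N : ℕ),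
    1 ≤ n → (N : ℝ) ≤ c * (n : ℝ) ^ d → IsRenaming n N (almostAdaptive G n N)
      (fun k => 3072 * Real.exp 4 * k) (fun k => B' * stepBound n k) := by
  obtain ⟨B, hB, h⟩ := exists_sum_polyLogCost_le (le_max_right c 1) d
  -- The extra 1, with `stepBound` at least 1, gives the strict inequality required by
  -- `almostAdaptive_run`.
  refine ⟨B + 1, fun B' hB' G n N hn hN => ?_⟩
  have hN' : (N : ℝ) ≤ max c 1 * (n : ℝ) ^ d :=
    hN.trans (mul_le_mul_of_nonneg_right (le_max_left _ _) (by positivity))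
  have hpos : ∀ {K : Finset ℕ} {p : ℕ}, p ∈ K → 1 ≤ K.card := fun hp =>
    Finset.card_pos.2 ⟨_, hp⟩
  refine ⟨fun K hK _ σ hσ p hp q hq hpq x y hx hy hxy => ?_, fun K hK hKn σ hσ p hp x hx => ?_,
    fun K hK hKn σ hσ p hp hT => ?_⟩
  · subst hxy
    exact hpq ((almostAdaptive_run G n N hK hσ).1 p hp q hq x hx hy)
  · obtain ⟨h1, h2⟩ := (almostAdaptive_run G n N hK hσ).2 p hp
    obtain ⟨h3, -⟩ := h2 _ (Nat.clog_mono_right 2 hKn) (Nat.le_pow_clog (by norm_num) _)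
    exact ⟨h1 x hx, (Nat.cast_le.2 (h3 x hx)).trans (phaseOffset_le (hpos hp) N)⟩
  · obtain ⟨-, h2⟩ := (almostAdaptive_run G n N hK hσ).2 p hp
    refine (h2 _ (Nat.clog_mono_right 2 hKn) (Nat.le_pow_clog (by norm_num) _)).2 ?_
    have h3 := h n N K.card hn (hpos hp) hN'
    have h4 := one_le_stepBound n K.card
    rw [← Nat.cast_lt (α := ℝ)]
    refine lt_of_lt_of_le ?_ hT
    nlinarith

/-- When `N ≤ c * n`, lg(N/2^i) is at most a constant plus m - i, where m = ⌈lg n⌉. Summed from the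
last phase backwards, 2^i(a + 2 + m - i) is 2^m times a convergent series. -/
theorem exists_usesAtMost_linear (c : ℝ) : ∃ B : ℝ, ∀ B' ≥ B, ∀ (G : ExpanderFamily) (n N : ℕ),
    1 ≤ n → (N : ℝ) ≤ c * n → UsesAtMost N (almostAdaptive G n N) (B' * n) := by
  set a := Real.logb 2 (max c 1) with ha
  have ha0 : 0 ≤ a := Real.logb_nonneg (by norm_num) (le_max_right _ _)
  have he := Real.exp_pos 4
  refine ⟨192 * Real.exp 4 * (4 * (a + 3)), fun B' hB' G n N hn hN => ?_⟩
  have hN' : (N : ℝ) ≤ max c 1 * n :=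
    hN.trans (mul_le_mul_of_nonneg_right (le_max_left _ _) (by positivity))
  have hc : 0 < max c 1 := lt_max_of_lt_right one_pos
  set m := Nat.clog 2 n with hm
  have hnm : (n : ℝ) ≤ 2 ^ m := by exact_mod_cast Nat.le_pow_clog (b := 2) (by norm_num) n
  have hmn : ((2 : ℝ) ^ m) ≤ 2 * n := by exact_mod_cast two_pow_clog_le hn
  refine usesAtMost_of_logb_le G n N (l := fun i => a + (m - i : ℕ)) (fun i => by positivity)
    (fun i hi h => ?_) ?_
  · have hN0 := pos_of_numEpochs_pos h
    have h1 : (N : ℝ) / 2 ^ i ≤ max c 1 * 2 ^ (m - i) := by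
      rw [div_le_iff₀ (by positivity), mul_assoc, ← pow_add, Nat.sub_add_cancel hi]
      exact hN'.trans (by gcongr)
    refine (Real.logb_le_logb_of_le (by norm_num) (by positivity) h1).trans (le_of_eq ?_)
    rw [Real.logb_mul hc.ne' (by positivity), Real.logb_pow, Real.logb_self_eq_one (by norm_num),
      mul_one]
  · rw [← Finset.sum_range_reflect]
    calc _ = ∑ s ∈ Finset.range (m + 1),
          192 * Real.exp 4 * 2 ^ m * ((a + 2 + s) / 2 ^ s) := by
          refine Finset.sum_congr rfl fun s hs => ?_
          have hs' : s ≤ m := Nat.lt_succ_iff.1 (Finset.mem_range.1 hs)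
          rw [Nat.add_sub_cancel, Nat.sub_sub_self hs', pow_sub₀ _ (by norm_num) hs']
          ring
      _ ≤ 192 * Real.exp 4 * (2 * n) * (2 * (a + 2 + 1)) := by
          rw [← Finset.mul_sum]
          gcongr
          exact sum_geometric_le (by positivity) _
      _ = 192 * Real.exp 4 * (4 * (a + 3)) * n := by ring
      _ ≤ B' * n := by gcongr

/-- Here the logarithm is bounded by a multiple of `lg n` in every phase alike, so the factor stays
in front of ∑ 2^i. -/
theorem exists_usesAtMost_polynomial (c : ℝ) (d : ℕ) : ∃ B : ℝ, ∀ B' ≥ B,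
    ∀ (G : ExpanderFamily) (n N : ℕ), 1 ≤ n → (N : ℝ) ≤ c * (n : ℝ) ^ d →
      UsesAtMost N (almostAdaptive G n N) (B' * (n * lg n)) := by
  set a := Real.logb 2 (max c 1) + d with ha
  have ha0 : 0 ≤ a :=
    add_nonneg (Real.logb_nonneg (by norm_num) (le_max_right _ _)) (Nat.cast_nonneg d)
  have he := Real.exp_pos 4
  refine ⟨192 * Real.exp 4 * (4 * (a + 2)), fun B' hB' G n N hn hN => ?_⟩
  have hN' : (N : ℝ) ≤ max c 1 * (n : ℝ) ^ d :=
    hN.trans (mul_le_mul_of_nonneg_right (le_max_left _ _) (by positivity))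
  have hmn : ((2 : ℝ) ^ Nat.clog 2 n) ≤ 2 * n := by exact_mod_cast two_pow_clog_le hn
  have h1 := one_le_lg n
  refine usesAtMost_of_logb_le G n N (l := fun _ => a * lg n) (fun i => by positivity)
    (fun i _ h => logb_div_le (le_max_right _ _) hn hN' i (pos_of_numEpochs_pos h)) ?_
  calc _ = (∑ i ∈ Finset.range (Nat.clog 2 n + 1), (2 : ℝ) ^ i) *
        (192 * Real.exp 4 * (a * lg n + 2)) := by rw [Finset.sum_mul]
    _ ≤ (2 * (2 * n)) * (192 * Real.exp 4 * ((a + 2) * lg n)) := by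
        gcongr
        · exact (sum_two_pow_le _).trans (by gcongr)
        · linarith
    _ = 192 * Real.exp 4 * (4 * (a + 2)) * (n * lg n) := by ring
    _ ≤ B' * (n * lg n) := by gcongr

end Renaming

theorem mainTheorem12 :
    Nonempty Renaming.ExpanderFamily ∧
    ∃ A : ℝ,
      (∀ c : ℝ, ∃ B : ℝ, ∀ (G : Renaming.ExpanderFamily) (n N : ℕ),
        1 ≤ n → (N : ℝ) ≤ c * n →
          Renaming.IsRenaming n N (Renaming.almostAdaptive G n N)
            (fun k => A * k) (fun k => B * Renaming.stepBound n k) ∧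
          Renaming.UsesAtMost N (Renaming.almostAdaptive G n N) (B * n)) ∧
      (∀ (c : ℝ) (d : ℕ), ∃ B : ℝ, ∀ (G : Renaming.ExpanderFamily) (n N : ℕ),
        1 ≤ n → (N : ℝ) ≤ c * (n : ℝ) ^ d →
          Renaming.IsRenaming n N (Renaming.almostAdaptive G n N)
            (fun k => A * k) (fun k => B * Renaming.stepBound n k) ∧
          Renaming.UsesAtMost N (Renaming.almostAdaptive G n N) (B * (n * Renaming.lg n))) := by
  refine ⟨Renaming.nonempty_expanderFamily, 3072 * Real.exp 4, fun c => ?_, fun c d => ?_⟩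
  · obtain ⟨B₁, h₁⟩ := Renaming.exists_isRenaming c 1
    obtain ⟨B₂, h₂⟩ := Renaming.exists_usesAtMost_linear c
    exact ⟨max B₁ B₂, fun G n N hn hN => ⟨h₁ _ (le_max_left _ _) G n N hn (by simpa using hN),
      h₂ _ (le_max_right _ _) G n N hn hN⟩⟩
  · obtain ⟨B₁, h₁⟩ := Renaming.exists_isRenaming c d
    obtain ⟨B₂, h₂⟩ := Renaming.exists_usesAtMost_polynomial c d
    exact ⟨max B₁ B₂, fun G n N hn hN => ⟨h₁ _ (le_max_left _ _) G n N hn hN,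
      h₂ _ (le_max_right _ _) G n N hn hN⟩⟩
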